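/- **Setting.** Let $n\ge 1$, $A\in\mathbb R^{n\times n}$, $b,c,K\in\mathbb R^n$ with $(A,b)$ controllable and $A_m=A-bK^\top$ Hurwitz. Put $H_o(s)=(sI-A_m)^{-1}b$ and $k_g=1/(c^\top H_o(0))$. Let $C(s)$ be a stable, strictly proper rational transfer function with $C(0)=1$. Let $Q$ be symmetric positive definite, $P$ the solution of $A_m^\top P+PA_m=-Q$, and $\Gamma_c>0$. Let $\Theta\subset\mathbb R^n$ be compact and convex, let $\theta:[0,\infty)\to\Theta$ be continuously differentiable with $\|\dot\theta(t)\|\le d_\theta$ for all $t\ge0$ (Euclidean norm), and let $r$ be a bounded continuous signal on $[0,\infty)$. Let $x_0\in\mathbb R^n$ and $\hat\theta_0\in\Theta$. *Adaptive closed loop.* The signals $x,u,\hat x,\hat\theta$ satisfy, for $t\ge 0$, $$\dot x=Ax+b\,(u-\theta^\top(t)x),\qquad u=-K^\top x+u_2,\qquad u_2(s)=C(s)\big(\bar r(s)+k_g r(s)\big),\qquad \bar r=\hat\theta^\top x,$$ $$\dot{\hat x}=A_m\hat x-b\,\hat\theta^\top x+b\,u_2,\qquad \dot{\hat\theta}=\Gamma_c\,\mathrm{Proj}\big(\hat\theta,\;x\,(\hat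 x-x)^\top Pb\big),$$ with $x(0)=\hat x(0)=x_0$ and $\hat\theta(0)=\hat\theta_0$. Here $\mathrm{Proj}(p,y)$ is the Euclidean nearest point to $y$ in the tangent cone of $\Theta$ at $p$ (the adaptive law is understood in the sense of Carathéodory), and the filter $C(s)$ starts from zero initial conditions. *Reference system.* The signals $x_{ref},u_{ref}$ satisfy the same plant equation $\dot x_{ref}=Ax_{ref}+b\,(u_{ref}-\theta^\top(t)x_{ref})$, $x_{ref}(0)=x_0$, with $$u_{ref}(s)=C(s)\big(k_g r(s)+\eta(s)\big)-K^\top x_{ref}(s),\qquad \eta(t)=\theta^\top(t)x_{ref}(t).$$ *Norms and constants.* For a signal, $\|\xi\|_{\mathcal L_\infty}=\max_i\sup_{t\ge0}|\xi_i(t)|$. For a stable proper system, $\|H\|_{\mathcal L_1}=\max_i\sum_j\|H_{ij}\|_{\mathcal L_1}$, where the $\mathcal L_1$ gain of a scalar system is the total mass $|g_0|+\int_0^\infty|h(t)|\,dt$ of its impulse response $g_0\delta+h$. Put $\theta_{\max}=\max_{\theta\in\Theta}\sum_i|\theta_i|$ and $$\theta_m=\max_{\theta\in\Theta}\sum_{i=1}^n4\theta_i^2+2\,\frac{d_\theta\,\lambda_{\max}(P)}{\lambda_{\min}(Q)}\,\max_{\theta\in\Theta}\|\theta\|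 .$$ **Theorem.** Assume the $\mathcal L_1$-gain requirement $\|H_o(s)(C(s)-1)\|_{\mathcal L_1}\,\theta_{\max}<1$. Then $$\|x-x_{ref}\|_{\mathcal L_\infty}\le\gamma_3=\frac{\|C(s)\|_{\mathcal L_1}}{1-\|H_o(s)(1-C(s))\|_{\mathcal L_1}\,\theta_{\max}}\sqrt{\frac{\theta_m}{\lambda_{\min}(P)\,\Gamma_c}} .$$ Moreover, there is $c_o\in\mathbb R^n$ such that $c_o^\top H_o(s)=N_n(s)/N_d(s)$ with stable polynomials $N_n,N_d$ and $\deg N_d=\deg N_n+1$, and for every such $c_o$ $$\|u-u_{ref}\|_{\mathcal L_\infty}\le\gamma_4=\Big\|C(s)\frac{1}{c_o^\top H_o(s)}c_o^\top\Big\|_{\mathcal L_1}\sqrt{\frac{\theta_m}{\lambda_{\min}(P)\,\Gamma_c}}+\Big(\sum_{i=1}^n|K_i|+\|C(s)\|_{\mathcal L_1}\,\theta_{\max}\Big)\gamma_3 .$$ -/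

import Mathlib

open scoped Matrix Polynomial ENNReal

noncomputable section

namespace L1Adaptive

/-! ### Scalar transfer functions -/

/-- A nonzero real polynomial all of whose complex roots lie in the open left half-plane. -/
def StablePoly (p : ℝ[X]) : Prop :=
  p ≠ 0 ∧ ∀ z : ℂ, Polynomial.aeval z p = 0 → z.re < 0

/-- A rational transfer function is stable if its (reduced) denominator is a stable polynomial. -/
def Stable (G : RatFunc ℝ) : Prop := StablePoly G.denom

/-- Strictly proper: the degree of the numerator is smaller than that of the denominator. -/
def StrictlyProper (G : RatFunc ℝ) : Prop := G.num.degree < G.denom.degree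

/-- The expansion `G(s) = g₀ + g₁ s⁻¹ + g₂ s⁻² + ⋯` at infinity of a proper rational function, as
a power series in the variable `s⁻¹`: if `G = p / q` with `N = deg q`, it is
`(s⁻ᴺ p(s)) / (s⁻ᴺ q(s))`. -/
def expansion (G : RatFunc ℝ) : PowerSeries ℝ :=
  ((G.num.reflect G.denom.natDegree : ℝ[X]) : PowerSeries ℝ) *
    ((G.denom.reflect G.denom.natDegree : ℝ[X]) : PowerSeries ℝ)⁻¹

/-- The direct feedthrough `g₀ = G(∞)` of a proper transfer function. -/
def feedthrough (G : RatFunc ℝ) : ℝ := PowerSeries.coeff 0 (expansion G)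

/-- The regular part of the impulse response of a proper transfer function `G`, that is, the inverse
Laplace transform of `G - G(∞)`: since `s⁻ᵏ⁻¹` is the Laplace transform of `tᵏ / k!`, it is
`h(t) = ∑ₖ gₖ₊₁ tᵏ / k!`. The full impulse response is `g₀ δ + h`. -/
def impulse (G : RatFunc ℝ) (t : ℝ) : ℝ :=
  ∑' k : ℕ, PowerSeries.coeff (k + 1) (expansion G) * t ^ k / (k.factorial : ℝ)

/-- The response at time `t`, with zero initial conditions, of the proper transfer function `G` to
the input signal `v`: the signal with Laplace transform `G(s) v(s)`. -/
def response (G : RatFunc ℝ) (v : ℝ → ℝ) (t : ℝ) : ℝ :=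
  feedthrough G * v t + ∫ τ in (0 : ℝ)..t, impulse G (t - τ) * v τ

/-- The `L₁` gain of a stable proper single-input single-output system: the total mass of its
impulse response `g₀ δ + h`. -/
def l1Gain (G : RatFunc ℝ) : ℝ :=
  |feedthrough G| + ∫ t in Set.Ioi (0 : ℝ), |impulse G t|

/-- The `L₁` gain of a stable proper system with `m` inputs and `p` outputs. -/
def l1GainMat {p m : ℕ} (H : Matrix (Fin p) (Fin m) (RatFunc ℝ)) : ℝ :=
  ⨆ i, ∑ j, l1Gain (H i j)

/-! ### Signals -/

/-- The `L∞` norm of a signal on `[0, ∞)`. For `E = Fin n → ℝ`, whose norm is the maximum of the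
absolute values of the components, it is `maxᵢ sup_{t ≥ 0} |ξᵢ(t)|`. -/
def linftyNorm {E : Type*} [NormedAddCommGroup E] (ξ : ℝ → E) : ℝ≥0∞ :=
  ⨆ t ∈ Set.Ici (0 : ℝ), ‖ξ t‖ₑ

/-! ### Linear systems -/

/-- All complex eigenvalues of `A` have negative real part. -/
def IsHurwitz {n : ℕ} (A : Matrix (Fin n) (Fin n) ℝ) : Prop :=
  ∀ z ∈ spectrum ℂ (A.map (algebraMap ℝ ℂ)), z.re < 0

/-- Controllability of the pair `(A, b)`: the vectors `b, A b, …, Aⁿ⁻¹ b` span `ℝⁿ`. -/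
def IsControllable {n : ℕ} (A : Matrix (Fin n) (Fin n) ℝ) (b : Fin n → ℝ) : Prop :=
  Submodule.span ℝ (Set.range fun k : Fin n => (A ^ (k : ℕ)) *ᵥ b) = ⊤

/-- `A_m = A - b Kᵀ`. -/
def Am {n : ℕ} (A : Matrix (Fin n) (Fin n) ℝ) (b K : Fin n → ℝ) : Matrix (Fin n) (Fin n) ℝ :=
  A - Matrix.vecMulVec b K

/-- The vector of transfer functions `H_o(s) = (s I - A_m)⁻¹ b`. -/
def Ho {n : ℕ} (A : Matrix (Fin n) (Fin n) ℝ) (b K : Fin n → ℝ) : Fin n → RatFunc ℝ :=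
  (Matrix.scalar (Fin n) (RatFunc.X : RatFunc ℝ) - (Am A b K).map RatFunc.C)⁻¹ *ᵥ
    fun i => RatFunc.C (b i)

/-- The scalar transfer function `vᵀ H_o(s)`. -/
def vecHo {n : ℕ} (A : Matrix (Fin n) (Fin n) ℝ) (b K v : Fin n → ℝ) : RatFunc ℝ :=
  ∑ i, RatFunc.C (v i) * Ho A b K i

/-- The feedforward gain `k_g = 1 / (cᵀ H_o(0))`. -/
def kg {n : ℕ} (A : Matrix (Fin n) (Fin n) ℝ) (b c K : Fin n → ℝ) : ℝ :=
  1 / RatFunc.eval (RingHom.id ℝ) 0 (vecHo A b K c)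

/-- `v ∈ ℝⁿ` is such that `vᵀ H_o(s) = N_n(s) / N_d(s)`, where `N_n` and `N_d` are stable polynomials
and the order of `N_d` is one more than the order of `N_n`. -/
def IsMinPhaseOutput {n : ℕ} (A : Matrix (Fin n) (Fin n) ℝ) (b K v : Fin n → ℝ) : Prop :=
  ∃ Nn Nd : ℝ[X], StablePoly Nn ∧ StablePoly Nd ∧ Nd.natDegree = Nn.natDegree + 1 ∧
    vecHo A b K v = algebraMap ℝ[X] (RatFunc ℝ) Nn / algebraMap ℝ[X] (RatFunc ℝ) Nd

/-- The column of transfer functions `H_o(s) (C(s) - 1)`. -/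
def Gbar {n : ℕ} (A : Matrix (Fin n) (Fin n) ℝ) (b K : Fin n → ℝ) (C : RatFunc ℝ) :
    Matrix (Fin n) (Fin 1) (RatFunc ℝ) :=
  fun i _ => Ho A b K i * (C - 1)

/-- The column of transfer functions `H_o(s) (1 - C(s))`. -/
def HoOneSub {n : ℕ} (A : Matrix (Fin n) (Fin n) ℝ) (b K : Fin n → ℝ) (C : RatFunc ℝ) :
    Matrix (Fin n) (Fin 1) (RatFunc ℝ) :=
  fun i _ => Ho A b K i * (1 - C)

/-- The row of transfer functions `C(s) (1 / (vᵀ H_o(s))) vᵀ`. -/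
def filteredInverse {n : ℕ} (A : Matrix (Fin n) (Fin n) ℝ) (b K : Fin n → ℝ) (C : RatFunc ℝ)
    (v : Fin n → ℝ) : Matrix (Fin 1) (Fin n) (RatFunc ℝ) :=
  fun _ j => C * (1 / vecHo A b K v) * RatFunc.C (v j)

/-! ### The projection operator of the adaptive law -/

/-- A point of `S` nearest to `y` in the Euclidean norm (unique if `S` is nonempty, closed and
convex). -/
def nearest {n : ℕ} (S : Set (EuclideanSpace ℝ (Fin n))) (y : EuclideanSpace ℝ (Fin n)) :
    EuclideanSpace ℝ (Fin n) :=
  Classical.epsilon fun z => z ∈ S ∧ ∀ w ∈ S, ‖y - z‖ ≤ ‖y - w‖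

/-- The tangent cone at `p` of a convex set `Θ`: the closure of the cone generated by `Θ - p`. -/
def tangentCone {n : ℕ} (Θ : Set (EuclideanSpace ℝ (Fin n))) (p : EuclideanSpace ℝ (Fin n)) :
    Set (EuclideanSpace ℝ (Fin n)) :=
  closure {v | ∃ a : ℝ, 0 ≤ a ∧ ∃ z ∈ Θ, v = a • (z - p)}

/-- The projection operator `Proj(p, y)` relative to the compact convex set `Θ`: the direction of
motion `y` is replaced by the nearest direction that is tangent to `Θ` at `p`. It is `y` itself if
`p` is an interior point, and at a smooth boundary point it removes from `y` the outward normal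
component, if there is one. -/
def proj {n : ℕ} (Θ : Set (EuclideanSpace ℝ (Fin n))) (p y : EuclideanSpace ℝ (Fin n)) :
    EuclideanSpace ℝ (Fin n) :=
  nearest (tangentCone Θ p) y

/-! ### Constants -/

/-- `θ_max`: the maximum over `Θ` of `∑ᵢ |θᵢ|`. -/
def thetaMax {n : ℕ} (Θ : Set (EuclideanSpace ℝ (Fin n))) : ℝ :=
  sSup ((fun p : EuclideanSpace ℝ (Fin n) => ∑ i, |p i|) '' Θ)

/-- The smallest eigenvalue of a symmetric real matrix. -/
def lamMin {n : ℕ} (M : Matrix (Fin n) (Fin n) ℝ) : ℝ := sInf (spectrum ℝ M)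

/-- The largest eigenvalue of a symmetric real matrix. -/
def lamMax {n : ℕ} (M : Matrix (Fin n) (Fin n) ℝ) : ℝ := sSup (spectrum ℝ M)

/-- `θ_m = max_Θ ∑ᵢ 4 θᵢ² + 2 (d_θ λ_max(P) / λ_min(Q)) max_Θ ‖θ‖`, with the Euclidean norm. -/
def thetaM {n : ℕ} (Θ : Set (EuclideanSpace ℝ (Fin n))) (P Q : Matrix (Fin n) (Fin n) ℝ)
    (dθ : ℝ) : ℝ :=
  sSup ((fun p : EuclideanSpace ℝ (Fin n) => ∑ i, 4 * p i ^ 2) '' Θ) +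
    2 * (dθ * lamMax P / lamMin Q) * sSup ((fun p : EuclideanSpace ℝ (Fin n) => ‖p‖) '' Θ)

/-- The bound for the state. -/
def gamma3 {n : ℕ} (A : Matrix (Fin n) (Fin n) ℝ) (b K : Fin n → ℝ) (C : RatFunc ℝ)
    (Θ : Set (EuclideanSpace ℝ (Fin n))) (P Q : Matrix (Fin n) (Fin n) ℝ) (Γc dθ : ℝ) : ℝ :=
  l1Gain C / (1 - l1GainMat (HoOneSub A b K C) * thetaMax Θ) *
    Real.sqrt (thetaM Θ P Q dθ / (lamMin P * Γc))

/-- The bound for the control; `∑ᵢ |Kᵢ|` is the `L₁` gain of the constant row `Kᵀ`. -/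
def gamma4 {n : ℕ} (A : Matrix (Fin n) (Fin n) ℝ) (b K : Fin n → ℝ) (C : RatFunc ℝ)
    (Θ : Set (EuclideanSpace ℝ (Fin n))) (P Q : Matrix (Fin n) (Fin n) ℝ) (Γc dθ : ℝ)
    (co : Fin n → ℝ) : ℝ :=
  l1GainMat (filteredInverse A b K C co) * Real.sqrt (thetaM Θ P Q dθ / (lamMin P * Γc)) +
    ((∑ i, |K i|) + l1Gain C * thetaMax Θ) * gamma3 A b K C Θ P Q Γc dθ

/-! ### The two closed loops -/

/-- The right-hand side `Γ_c Proj(θ̂, x x̃ᵀ P b)`, `x̃ = x̂ - x`, of the adaptive law. -/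
def adaptRate {n : ℕ} (Θ : Set (EuclideanSpace ℝ (Fin n))) (P : Matrix (Fin n) (Fin n) ℝ)
    (b : Fin n → ℝ) (Γc : ℝ) (θhat : EuclideanSpace ℝ (Fin n)) (x xhat : Fin n → ℝ) :
    EuclideanSpace ℝ (Fin n) :=
  Γc • proj Θ θhat (WithLp.toLp 2 (((xhat - x) ⬝ᵥ (P *ᵥ b)) • x))

/-- `x`, `u` are the state and the control of the plant
`x' = A x + b (u - θ(t)ᵀ x)`, `x(0) = x₀`, on `[0, ∞)`. -/
structure IsPlant {n : ℕ} (A : Matrix (Fin n) (Fin n) ℝ) (b : Fin n → ℝ) (x₀ : Fin n → ℝ)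
    (θ : ℝ → EuclideanSpace ℝ (Fin n)) (x : ℝ → Fin n → ℝ) (u : ℝ → ℝ) : Prop where
  init : x 0 = x₀
  ode : ∀ t, 0 ≤ t →
    HasDerivWithinAt x (A *ᵥ x t + (u t - (θ t).ofLp ⬝ᵥ x t) • b) (Set.Ici 0) t

/-- `x`, `u`, `x̂`, `θ̂` are the signals of the plant in closed loop with the adaptive controller:
state predictor, adaptive law and control law. The right-hand side of the adaptive law is
discontinuous at the boundary of `Θ`; its solutions are understood in the sense of Carathéodory. -/
structure IsAdaptiveLoop {n : ℕ} (A : Matrix (Fin n) (Fin n) ℝ) (b c K : Fin n → ℝ)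
    (C : RatFunc ℝ) (Θ : Set (EuclideanSpace ℝ (Fin n))) (P : Matrix (Fin n) (Fin n) ℝ) (Γc : ℝ)
    (r : ℝ → ℝ) (x₀ : Fin n → ℝ) (θhat₀ : EuclideanSpace ℝ (Fin n))
    (θ : ℝ → EuclideanSpace ℝ (Fin n)) (x : ℝ → Fin n → ℝ) (u : ℝ → ℝ)
    (xhat : ℝ → Fin n → ℝ) (θhat : ℝ → EuclideanSpace ℝ (Fin n)) : Prop where
  plant : IsPlant A b x₀ θ x u
  /-- `u = u₁ + u₂`, `u₁ = -Kᵀ x`, `u₂(s) = C(s) (r̄(s) + k_g r(s))`, `r̄ = θ̂ᵀ x`. -/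
  control : ∀ t, 0 ≤ t →
    u t = -(K ⬝ᵥ x t) + response C (fun τ => (θhat τ).ofLp ⬝ᵥ x τ + kg A b c K * r τ) t
  predictor_init : xhat 0 = x₀
  /-- `x̂' = A_m x̂ - b θ̂ᵀ x + b u₂`, where `u₂ = u + Kᵀ x`. -/
  predictor : ∀ t, 0 ≤ t →
    HasDerivWithinAt xhat
      (Am A b K *ᵥ xhat t - ((θhat t).ofLp ⬝ᵥ x t) • b + (u t + K ⬝ᵥ x t) • b) (Set.Ici 0) t
  adapt_integrable : ∀ t, 0 ≤ t → IntervalIntegrable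
    (fun τ => adaptRate Θ P b Γc (θhat τ) (x τ) (xhat τ)) MeasureTheory.volume 0 t
  adapt : ∀ t, 0 ≤ t →
    θhat t = θhat₀ + ∫ τ in (0 : ℝ)..t, adaptRate Θ P b Γc (θhat τ) (x τ) (xhat τ)

/-- `x_ref`, `u_ref` are the signals of the closed-loop reference system: the same plant, from the
same initial state, with the non-adaptive control
`u_ref(s) = C(s) (k_g r(s) + η(s)) - Kᵀ x_ref(s)`, `η = θᵀ x_ref`. -/
structure IsReferenceLoop {n : ℕ} (A : Matrix (Fin n) (Fin n) ℝ) (b c K : Fin n → ℝ)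
    (C : RatFunc ℝ) (r : ℝ → ℝ) (x₀ : Fin n → ℝ) (θ : ℝ → EuclideanSpace ℝ (Fin n))
    (xref : ℝ → Fin n → ℝ) (uref : ℝ → ℝ) : Prop where
  plant : IsPlant A b x₀ θ xref uref
  control : ∀ t, 0 ≤ t →
    uref t = response C (fun τ => kg A b c K * r τ + (θ τ).ofLp ⬝ᵥ xref τ) t - K ⬝ᵥ xref t

end L1Adaptive

end

noncomputable section

namespace L1Adaptive

/-! ### Proper rational functions and their expansions at infinity -/

/-! Let `x̃ = x̂ - x` be the prediction error, `e = x - x_ref` the tracking error and `w = -(θ̂ -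
θ)ᵀx`. Both errors start at zero. The proof bounds `x̃` by a Lyapunov argument and then carries that
bound to `e` and to `u - u_ref` through the algebra of transfer functions.

Lyapunov part (`IsAdaptiveLoop.lyapunov_bound`, `IsAdaptiveLoop.norm_sub_le`). From `x̃' = A_m x̃ +
b w`, the adaptive law cancels the cross term in the derivative of `Γ_c x̃ᵀP x̃ + ‖θ̂ - θ‖²`; the
projection only helps and keeps `θ̂` in `Θ`. What remains is `-Γ_c x̃ᵀQ x̃` and a term from the
drift of `θ`. A barrier argument for absolutely continuous functions
(`le_of_hasDerivAt_nonpos_above`) then gives `‖x̃‖ ≤ √(θ_m / (λ_min(P) Γ_c))`. Subtracting `‖θ‖²`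
from the Lyapunov function halves the drift term, which yields the constant `θ_m`.

Input-output part (`error_identities`). The state equations say `x̃ = H_o w` and `e = H_o (C (θᵀe -
w) - θᵀe)`, whence `e = H_o (C - 1) θᵀe - C x̃`. The gain requirement makes this a contraction
estimate (`norm_state_sub_le`), giving `γ₃`. For the control, `C w` is recovered from `x̃` as `C
(c_oᵀH_o)⁻¹ c_oᵀ x̃`, a stable proper operation because `c_oᵀH_o` has stable numerator and relative
degree one while `C` is strictly proper. This gives `γ₄`.

These identities are proved on each `[0, T]` without Laplace transforms. With `J` integration from
`0`, the response of a proper `G = ∑ gₖ s⁻ᵏ` is the operator `∑ gₖ Jᵏ` (`ioOp_apply`), so products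
of transfer functions become compositions (`ioOp_mul`), with no growth condition on signals and no
stability. Stability enters only to make impulse responses integrable (`expDecay_impulse`), so that
gains bound responses (`abs_response_le`).

A suitable `c_o` exists because controllability makes the `n` entries of `adj(sI - A_m) b` a basis
of the polynomials of degree below `n`, so that `(s + 1)ⁿ⁻¹` is a possible numerator. -/

/-- The degree of the numerator is at most that of the denominator. -/
def Proper (G : RatFunc ℝ) : Prop := G.intDegree ≤ 0

theorem Proper.natDegree_le {G : RatFunc ℝ} (h : Proper G) :
    G.num.natDegree ≤ G.denom.natDegree := by
  unfold Proper RatFunc.intDegree at h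
  omega

theorem StrictlyProper.intDegree_neg {G : RatFunc ℝ} (h : StrictlyProper G) (h0 : G ≠ 0) :
    G.intDegree < 0 := by
  have := Polynomial.natDegree_lt_natDegree (RatFunc.num_ne_zero h0) h
  unfold RatFunc.intDegree
  omega

theorem proper_zero : Proper 0 := by simp [Proper]

theorem proper_one : Proper 1 := by simp [Proper]

theorem proper_C (a : ℝ) : Proper (RatFunc.C a) := by simp [Proper]

theorem Proper.mul {G H : RatFunc ℝ} (hG : Proper G) (hH : Proper H) : Proper (G * H) := by
  by_cases h1 : G = 0
  · simpa [h1] using proper_zero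
  by_cases h2 : H = 0
  · simpa [h2] using proper_zero
  unfold Proper at *
  rw [RatFunc.intDegree_mul h1 h2]
  omega

theorem Proper.add {G H : RatFunc ℝ} (hG : Proper G) (hH : Proper H) : Proper (G + H) := by
  by_cases h1 : H = 0
  · simpa [h1] using hG
  by_cases h2 : G + H = 0
  · simpa [h2] using proper_zero
  unfold Proper at *
  exact (RatFunc.intDegree_add_le h1 h2).trans (max_le hG hH)

theorem Proper.neg {G : RatFunc ℝ} (hG : Proper G) : Proper (-G) := by
  unfold Proper at *
  rwa [RatFunc.intDegree_neg]

theorem Proper.sub {G H : RatFunc ℝ} (hG : Proper G) (hH : Proper H) : Proper (G - H) := by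
  rw [sub_eq_add_neg]
  exact hG.add hH.neg

theorem Proper.sum {ι : Type*} (s : Finset ι) {G : ι → RatFunc ℝ} (h : ∀ i ∈ s, Proper (G i)) :
    Proper (∑ i ∈ s, G i) :=
  Finset.sum_induction _ Proper (fun _ _ => Proper.add) proper_zero h

theorem intDegree_div_polynomial {p q : ℝ[X]} (hp : p ≠ 0) (hq : q ≠ 0) :
    (algebraMap ℝ[X] (RatFunc ℝ) p / algebraMap ℝ[X] (RatFunc ℝ) q).intDegree =
      (p.natDegree : ℤ) - q.natDegree := by
  rw [RatFunc.intDegree_div (RatFunc.algebraMap_ne_zero hp) (RatFunc.algebraMap_ne_zero hq),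
    RatFunc.intDegree_polynomial, RatFunc.intDegree_polynomial]

theorem proper_div {p q : ℝ[X]} (hq : q ≠ 0) (h : p.natDegree ≤ q.natDegree) :
    Proper (algebraMap ℝ[X] (RatFunc ℝ) p / algebraMap ℝ[X] (RatFunc ℝ) q) := by
  by_cases hp : p = 0
  · simpa [hp] using proper_zero
  unfold Proper
  rw [intDegree_div_polynomial hp hq]
  omega

theorem coe_reflect_ne_zero {q : ℝ[X]} (hq : q ≠ 0) (N : ℕ) :
    ((q.reflect N : ℝ[X]) : PowerSeries ℝ) ≠ 0 := by
  simpa using hq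

theorem coeff_reflect_zero_denom (G : RatFunc ℝ) :
    (G.denom.reflect G.denom.natDegree).coeff 0 = 1 := by
  rw [Polynomial.coeff_reflect, Polynomial.revAt_le (Nat.zero_le _), Nat.sub_zero]
  exact (RatFunc.monic_denom G)

theorem expansion_mul_reflect_denom (G : RatFunc ℝ) :
    expansion G * ((G.denom.reflect G.denom.natDegree : ℝ[X]) : PowerSeries ℝ) =
      ((G.num.reflect G.denom.natDegree : ℝ[X]) : PowerSeries ℝ) := by
  unfold expansion
  rw [mul_assoc, PowerSeries.inv_mul_cancel, mul_one]
  rw [← PowerSeries.coeff_zero_eq_constantCoeff_apply, Polynomial.coeff_coe,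
    coeff_reflect_zero_denom]
  exact one_ne_zero

/-- The fraction need not be reduced and `N` may exceed both degrees: reversal is multiplicative
when the degree bounds add, so it can be applied to the cross-multiplied identity. Together with
cancellation this characterises the expansion by any fraction, which is how sums and products are
handled. -/
theorem expansion_mul_reflect {G : RatFunc ℝ} (hG : Proper G) {p q : ℝ[X]} (hq : q ≠ 0)
    (h : G = algebraMap ℝ[X] (RatFunc ℝ) p / algebraMap ℝ[X] (RatFunc ℝ) q) {N : ℕ}
    (hp : p.natDegree ≤ N) (hqN : q.natDegree ≤ N) :
    expansion G * ((q.reflect N : ℝ[X]) : PowerSeries ℝ) =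
      ((p.reflect N : ℝ[X]) : PowerSeries ℝ) := by
  have hpoly : p * G.denom = G.num * q := by
    have h1 := RatFunc.num_div_denom G
    have hd := RatFunc.algebraMap_ne_zero (RatFunc.denom_ne_zero G)
    have hq' := RatFunc.algebraMap_ne_zero hq
    apply RatFunc.algebraMap_injective ℝ
    rw [map_mul, map_mul]
    rw [← h1] at h
    rw [div_eq_div_iff hd hq'] at h
    exact h.symm
  have e1 := congrArg (Polynomial.reflect (N + G.denom.natDegree)) hpoly
  rw [Polynomial.reflect_mul _ _ hp le_rfl, mul_comm G.num q,
    Polynomial.reflect_mul _ _ hqN hG.natDegree_le] at e1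
  have e2 := congrArg (fun f : ℝ[X] => (f : PowerSeries ℝ)) e1
  simp only [Polynomial.coe_mul] at e2
  rw [← expansion_mul_reflect_denom G] at e2
  apply mul_right_cancel₀ (coe_reflect_ne_zero (RatFunc.denom_ne_zero G) G.denom.natDegree)
  rw [e2]
  ring

theorem expansion_eq_of_mul_reflect {G : RatFunc ℝ} (hG : Proper G) {p q : ℝ[X]} (hq : q ≠ 0)
    (h : G = algebraMap ℝ[X] (RatFunc ℝ) p / algebraMap ℝ[X] (RatFunc ℝ) q) {N : ℕ}
    (hp : p.natDegree ≤ N) (hqN : q.natDegree ≤ N) {f : PowerSeries ℝ}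
    (hf : f * ((q.reflect N : ℝ[X]) : PowerSeries ℝ) = ((p.reflect N : ℝ[X]) : PowerSeries ℝ)) :
    expansion G = f :=
  mul_right_cancel₀ (coe_reflect_ne_zero hq N)
    ((expansion_mul_reflect hG hq h hp hqN).trans hf.symm)

theorem expansion_mul {G H : RatFunc ℝ} (hG : Proper G) (hH : Proper H) :
    expansion (G * H) = expansion G * expansion H := by
  refine expansion_eq_of_mul_reflect (hG.mul hH) (p := G.num * H.num) (q := G.denom * H.denom)
    (N := G.denom.natDegree + H.denom.natDegree)
    (mul_ne_zero (RatFunc.denom_ne_zero G) (RatFunc.denom_ne_zero H)) ?_ ?_ ?_ ?_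
  · rw [map_mul, map_mul, mul_div_mul_comm, RatFunc.num_div_denom, RatFunc.num_div_denom]
  · exact Polynomial.natDegree_mul_le.trans (add_le_add hG.natDegree_le hH.natDegree_le)
  · exact Polynomial.natDegree_mul_le
  · rw [Polynomial.reflect_mul _ _ le_rfl le_rfl,
      Polynomial.reflect_mul _ _ hG.natDegree_le hH.natDegree_le, Polynomial.coe_mul,
      Polynomial.coe_mul, ← expansion_mul_reflect_denom G, ← expansion_mul_reflect_denom H]
    ring

theorem expansion_add {G H : RatFunc ℝ} (hG : Proper G) (hH : Proper H) :
    expansion (G + H) = expansion G + expansion H := by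
  have hG0 := RatFunc.algebraMap_ne_zero (RatFunc.denom_ne_zero G)
  have hH0 := RatFunc.algebraMap_ne_zero (RatFunc.denom_ne_zero H)
  refine expansion_eq_of_mul_reflect (hG.add hH) (p := G.num * H.denom + G.denom * H.num)
    (q := G.denom * H.denom) (N := G.denom.natDegree + H.denom.natDegree)
    (mul_ne_zero (RatFunc.denom_ne_zero G) (RatFunc.denom_ne_zero H)) ?_ ?_ ?_ ?_
  · rw [map_add, map_mul, map_mul, map_mul, ← div_add_div _ _ hG0 hH0, RatFunc.num_div_denom,
      RatFunc.num_div_denom]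
  · refine Polynomial.natDegree_add_le_of_degree_le ?_ ?_
    · exact Polynomial.natDegree_mul_le.trans (add_le_add hG.natDegree_le le_rfl)
    · exact Polynomial.natDegree_mul_le.trans (add_le_add le_rfl hH.natDegree_le)
  · exact Polynomial.natDegree_mul_le
  · rw [Polynomial.reflect_add, Polynomial.reflect_mul _ _ le_rfl le_rfl,
      Polynomial.reflect_mul _ _ hG.natDegree_le le_rfl,
      Polynomial.reflect_mul _ _ le_rfl hH.natDegree_le, Polynomial.coe_mul, Polynomial.coe_add,
      Polynomial.coe_mul, Polynomial.coe_mul, ← expansion_mul_reflect_denom G,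
      ← expansion_mul_reflect_denom H]
    ring

theorem expansion_C (a : ℝ) : expansion (RatFunc.C a) = PowerSeries.C a := by
  refine expansion_eq_of_mul_reflect (proper_C a) (p := Polynomial.C a) (q := 1) (N := 0)
    one_ne_zero ?_ (by simp) (by simp) ?_
  · simp
  · simp [Polynomial.reflect_one]

theorem proper_inv_X : Proper (RatFunc.X : RatFunc ℝ)⁻¹ := by
  simp [Proper]

theorem expansion_inv_X : expansion (RatFunc.X : RatFunc ℝ)⁻¹ = PowerSeries.X := by
  refine expansion_eq_of_mul_reflect proper_inv_X (p := 1) (q := Polynomial.X) (N := 1)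
    Polynomial.X_ne_zero ?_ (by simp) (by simp) ?_
  · simp
  · simp [Polynomial.reflect_one, Polynomial.reflect_one_X]

/-! ### Geometric growth of the coefficients -/

/-- A sequence that grows at most geometrically. -/
def GeomBdd {𝕜 : Type*} [Norm 𝕜] (a : ℕ → 𝕜) : Prop :=
  ∃ M ρ : ℝ, 0 ≤ M ∧ 0 ≤ ρ ∧ ∀ k, ‖a k‖ ≤ M * ρ ^ k

/-- Since `q` has constant term `1`, comparing coefficients is a recursion for `fₙ` in terms of the
earlier ones. With `B` and `S` the coefficient sums of `p` and `q`, the ratio `1 + S` closes the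
induction: `B ρⁿ + B ρⁿ S = B ρⁿ⁺¹`. -/
theorem geomBdd_of_mul_eq {f : PowerSeries ℝ} {p q : ℝ[X]} (hq : q.coeff 0 = 1)
    (h : f * (q : PowerSeries ℝ) = (p : PowerSeries ℝ)) :
    GeomBdd fun n => PowerSeries.coeff n f := by
  set B : ℝ := ∑ i ∈ p.support, |p.coeff i| with hB
  set S : ℝ := ∑ i ∈ q.support, |q.coeff i| with hS
  have hB0 : 0 ≤ B := Finset.sum_nonneg fun _ _ => abs_nonneg _
  have hS0 : 0 ≤ S := Finset.sum_nonneg fun _ _ => abs_nonneg _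
  have hpB : ∀ n, |p.coeff n| ≤ B := by
    intro n
    by_cases hn : n ∈ p.support
    · exact Finset.single_le_sum (f := fun i => |p.coeff i|) (fun _ _ => abs_nonneg _) hn
    · simpa [Polynomial.notMem_support_iff.mp hn] using hB0
  refine ⟨B, 1 + S, hB0, by positivity, fun n => ?_⟩
  beta_reduce
  induction n using Nat.strong_induction_on with
  | _ n ih =>
  have e := congrArg (PowerSeries.coeff n) h
  rw [PowerSeries.coeff_mul, Polynomial.coeff_coe,
    Finset.Nat.sum_antidiagonal_eq_sum_range_succ_mk, Finset.sum_range_succ] at e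
  simp only [Polynomial.coeff_coe, Nat.sub_self, hq, mul_one] at e
  rcases n with _ | n
  · simp only [Finset.range_zero, Finset.sum_empty, zero_add] at e
    rw [e]
    simpa using hpB 0
  have e' : PowerSeries.coeff (n + 1) f = p.coeff (n + 1) -
      ∑ i ∈ Finset.range (n + 1), PowerSeries.coeff i f * q.coeff (n + 1 - i) := by
    rw [← e]; ring
  rw [e', Real.norm_eq_abs]
  have hsum : |∑ i ∈ Finset.range (n + 1), PowerSeries.coeff i f * q.coeff (n + 1 - i)| ≤
      B * (1 + S) ^ n * S := by
    calc _ ≤ ∑ i ∈ Finset.range (n + 1), |PowerSeries.coeff i f * q.coeff (n + 1 - i)| :=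
          Finset.abs_sum_le_sum_abs _ _
      _ ≤ ∑ i ∈ Finset.range (n + 1), B * (1 + S) ^ n * |q.coeff (n + 1 - i)| := by
          refine Finset.sum_le_sum fun i hi => ?_
          have hi' := Finset.mem_range.mp hi
          rw [abs_mul]
          refine mul_le_mul_of_nonneg_right ((ih i hi').trans ?_) (abs_nonneg _)
          exact mul_le_mul_of_nonneg_left
            (pow_le_pow_right₀ (by linarith) (Nat.lt_succ_iff.mp hi')) hB0
      _ = B * (1 + S) ^ n * ∑ i ∈ Finset.range (n + 1), |q.coeff (n + 1 - i)| := by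
          rw [Finset.mul_sum]
      _ ≤ B * (1 + S) ^ n * S := by
          refine mul_le_mul_of_nonneg_left ?_ (by positivity)
          have : ∑ i ∈ Finset.range (n + 1), |q.coeff (n + 1 - i)| =
              ∑ j ∈ (Finset.range (n + 1)).image (fun i => n + 1 - i), |q.coeff j| := by
            rw [Finset.sum_image]
            intro i hi j hj hij
            simp only [Finset.coe_range, Set.mem_Iio] at hi hj
            simp only at hij
            omega
          rw [this, ← Finset.sum_filter_of_ne (p := fun j => j ∈ q.support)
            (fun j _ hj => by simpa using hj)]
          exact Finset.sum_le_sum_of_subset_of_nonneg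
            (fun j hj => (Finset.mem_filter.mp hj).2) fun _ _ _ => abs_nonneg _
  have h1 : (1 : ℝ) ≤ (1 + S) ^ n := one_le_pow₀ (by linarith)
  calc _ ≤ |p.coeff (n + 1)| + _ := abs_sub _ _
    _ ≤ B * (1 + S) ^ n + B * (1 + S) ^ n * S :=
        add_le_add ((hpB _).trans (le_mul_of_one_le_right hB0 h1)) hsum
    _ = B * (1 + S) ^ (n + 1) := by ring

theorem geomBdd_expansion (G : RatFunc ℝ) : GeomBdd fun n => PowerSeries.coeff n (expansion G) :=
  geomBdd_of_mul_eq (coeff_reflect_zero_denom G) (expansion_mul_reflect_denom G)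

/-- The coefficients of the expansion satisfy the linear recurrence given by the denominator. -/
theorem sum_denom_coeff_mul_expansion {G : RatFunc ℝ} (hG : Proper G) (k : ℕ) :
    ∑ j ∈ Finset.range (G.denom.natDegree + 1),
      G.denom.coeff j * PowerSeries.coeff (k + j + 1) (expansion G) = 0 := by
  set N := G.denom.natDegree with hN
  -- The index `N + k + 1` lies beyond the degree of both reversed polynomials, so the right side
  -- vanishes and only `N + 1` terms of the convolution survive.
  have e := congrArg (PowerSeries.coeff (N + k + 1)) (expansion_mul_reflect_denom G)
  rw [mul_comm, PowerSeries.coeff_mul, Polynomial.coeff_coe, ← hN, Polynomial.coeff_reflect,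
    Polynomial.revAt_eq_self_of_lt (by omega), Polynomial.coeff_eq_zero_of_natDegree_lt
      (lt_of_le_of_lt hG.natDegree_le (by omega)),
    Finset.Nat.sum_antidiagonal_eq_sum_range_succ_mk] at e
  rw [← Finset.sum_range_reflect]
  rw [← e]
  symm
  have hsub : Finset.range (N + 1) ⊆ Finset.range (N + k + 1).succ := by
    intro i hi
    simp only [Finset.mem_range] at *
    omega
  rw [← Finset.sum_subset hsub]
  · refine Finset.sum_congr rfl fun i hi => ?_
    simp only [Finset.mem_range] at hi
    simp only [Polynomial.coeff_coe, Polynomial.coeff_reflect]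
    rw [Polynomial.revAt_le (by omega)]
    rw [show N + k + 1 - i = k + (N + 1 - 1 - i) + 1 by omega, Nat.add_sub_cancel]
  · intro i _ hi
    simp only [Finset.mem_range, not_lt] at hi
    simp only [Polynomial.coeff_coe, Polynomial.coeff_reflect]
    rw [Polynomial.revAt_eq_self_of_lt (by omega), Polynomial.coeff_eq_zero_of_natDegree_lt
      (by omega), zero_mul]

/-! ### Exponential generating functions -/

section ExpSum

variable {𝕜 : Type*} [RCLike 𝕜]

theorem GeomBdd.shift {a : ℕ → 𝕜} (ha : GeomBdd a) : GeomBdd fun k => a (k + 1) := by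
  obtain ⟨M, ρ, hM, hρ, h⟩ := ha
  refine ⟨M * ρ, ρ, by positivity, hρ, fun k => (h (k + 1)).trans (le_of_eq ?_)⟩
  ring

theorem GeomBdd.const_mul {a : ℕ → 𝕜} (ha : GeomBdd a) (c : 𝕜) : GeomBdd fun k => c * a k := by
  obtain ⟨M, ρ, hM, hρ, h⟩ := ha
  refine ⟨‖c‖ * M, ρ, by positivity, hρ, fun k => ?_⟩
  rw [norm_mul, mul_assoc]
  exact mul_le_mul_of_nonneg_left (h k) (norm_nonneg c)

theorem GeomBdd.sub {a b : ℕ → 𝕜} (ha : GeomBdd a) (hb : GeomBdd b) :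
    GeomBdd fun k => a k - b k := by
  obtain ⟨M, ρ, hM, hρ, h⟩ := ha
  obtain ⟨M', ρ', hM', hρ', h'⟩ := hb
  refine ⟨M + M', max ρ ρ', by positivity, le_max_of_le_left hρ, fun k => ?_⟩
  calc ‖a k - b k‖ ≤ ‖a k‖ + ‖b k‖ := norm_sub_le _ _
    _ ≤ M * ρ ^ k + M' * ρ' ^ k := add_le_add (h k) (h' k)
    _ ≤ M * max ρ ρ' ^ k + M' * max ρ ρ' ^ k := by
        gcongr
        · exact le_max_left _ _
        · exact le_max_right _ _
    _ = (M + M') * max ρ ρ' ^ k := by ring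

/-- The exponential generating function `∑ₖ aₖ tᵏ / k!`. -/
def expSum (a : ℕ → 𝕜) (t : ℝ) : 𝕜 := ∑' k : ℕ, a k * (t : 𝕜) ^ k / (k.factorial : 𝕜)

theorem norm_expSum_term_le {a : ℕ → 𝕜} {M ρ : ℝ} (h : ∀ k, ‖a k‖ ≤ M * ρ ^ k) {t R : ℝ}
    (ht : |t| ≤ R) (k : ℕ) :
    ‖a k * (t : 𝕜) ^ k / (k.factorial : 𝕜)‖ ≤ M * ((ρ * R) ^ k / k.factorial) := by
  rw [norm_div, norm_mul, norm_pow, RCLike.norm_ofReal, RCLike.norm_natCast, mul_pow]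
  calc ‖a k‖ * |t| ^ k / (k.factorial : ℝ) ≤ (M * ρ ^ k) * R ^ k / (k.factorial : ℝ) := by
        have := h k
        gcongr
        exact (norm_nonneg _).trans this
    _ = _ := by ring

theorem GeomBdd.summable_expSum {a : ℕ → 𝕜} (ha : GeomBdd a) (t : ℝ) :
    Summable fun k : ℕ => a k * (t : 𝕜) ^ k / (k.factorial : 𝕜) := by
  obtain ⟨M, ρ, hM, hρ, h⟩ := ha
  exact Summable.of_norm_bounded ((Real.summable_pow_div_factorial (ρ * |t|)).mul_left M)
    (norm_expSum_term_le h le_rfl)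

theorem expSum_sub {a b : ℕ → 𝕜} (ha : GeomBdd a) (hb : GeomBdd b) (t : ℝ) :
    expSum (fun k => a k - b k) t = expSum a t - expSum b t := by
  unfold expSum
  rw [← (ha.summable_expSum t).tsum_sub (hb.summable_expSum t)]
  refine tsum_congr fun k => ?_
  ring

theorem expSum_const_mul (a : ℕ → 𝕜) (c : 𝕜) (t : ℝ) :
    expSum (fun k => c * a k) t = c * expSum a t := by
  unfold expSum
  rw [← tsum_mul_left]
  refine tsum_congr fun k => ?_
  ring

theorem expSum_sum {ι : Type*} (s : Finset ι) {a : ι → ℕ → 𝕜} (ha : ∀ i ∈ s, GeomBdd (a i))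
    (t : ℝ) : expSum (fun k => ∑ i ∈ s, a i k) t = ∑ i ∈ s, expSum (a i) t := by
  unfold expSum
  rw [← Summable.tsum_finsetSum fun i hi => (ha i hi).summable_expSum t]
  refine tsum_congr fun k => ?_
  rw [Finset.sum_mul, Finset.sum_div]

theorem expSum_zero_right (a : ℕ → 𝕜) : expSum a 0 = a 0 := by
  unfold expSum
  rw [tsum_eq_single 0]
  · simp
  · intro k hk
    simp [hk]

theorem expSum_ofReal (a : ℕ → ℝ) (t : ℝ) :
    ((expSum a t : ℝ) : ℂ) = expSum (fun k => (a k : ℂ)) t := by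
  unfold expSum
  rw [Complex.ofReal_tsum]
  refine tsum_congr fun k => ?_
  push_cast
  rfl

/-- Termwise differentiation shifts the sequence; on the ball of radius `|t| + 1` the derivatives
are dominated by an exponential series. -/
theorem GeomBdd.hasDerivAt_expSum {a : ℕ → 𝕜} (ha : GeomBdd a) (t : ℝ) :
    HasDerivAt (expSum a) (expSum (fun k => a (k + 1)) t) t := by
  have hshift := ha.shift
  obtain ⟨M, ρ, hM, hρ, h⟩ := hshift
  set R : ℝ := |t| + 1 with hR
  have hterm : ∀ k : ℕ, ∀ s : ℝ,
      HasDerivAt (fun s : ℝ => a (k + 1) * (s : 𝕜) ^ (k + 1) / ((k + 1).factorial : 𝕜))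
        (a (k + 1) * (s : 𝕜) ^ k / (k.factorial : 𝕜)) s := by
    intro k s
    have h1 : HasDerivAt (fun s : ℝ => (s : 𝕜)) 1 s := by
      simpa using (RCLike.ofRealCLM (K := 𝕜)).hasFDerivAt.hasDerivAt (x := s)
    have h2 := ((h1.pow (k + 1)).const_mul (a (k + 1))).div_const ((k + 1).factorial : 𝕜)
    refine h2.congr_deriv ?_
    have hk : ((k : 𝕜) + 1) ≠ 0 := by exact_mod_cast Nat.succ_ne_zero k
    have hk' : ((k.factorial : ℕ) : 𝕜) ≠ 0 := by exact_mod_cast Nat.factorial_ne_zero k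
    rw [Nat.factorial_succ, Nat.add_sub_cancel]
    push_cast
    field_simp
  have key : HasDerivAt
      (fun s : ℝ => ∑' k : ℕ, a (k + 1) * (s : 𝕜) ^ (k + 1) / ((k + 1).factorial : 𝕜))
      (expSum (fun k => a (k + 1)) t) t := by
    have htR : t ∈ Metric.ball (0 : ℝ) R := by simp [hR]
    have hbound : ∀ k : ℕ, ∀ s ∈ Metric.ball (0 : ℝ) R,
        ‖a (k + 1) * (s : 𝕜) ^ k / (k.factorial : 𝕜)‖ ≤ M * ((ρ * R) ^ k / k.factorial) :=
      fun k s hs => norm_expSum_term_le h (mem_ball_zero_iff.mp hs).le k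
    have hs0 := (summable_nat_add_iff 1).mpr (ha.summable_expSum t)
    exact hasDerivAt_tsum_of_isPreconnected
      (g := fun (k : ℕ) (s : ℝ) => a (k + 1) * (s : 𝕜) ^ (k + 1) / ((k + 1).factorial : 𝕜))
      (g' := fun (k : ℕ) (s : ℝ) => a (k + 1) * (s : 𝕜) ^ k / (k.factorial : 𝕜))
      ((Real.summable_pow_div_factorial (ρ * R)).mul_left M) Metric.isOpen_ball
      (convex_ball (0 : ℝ) R).isPreconnected (fun k s _ => hterm k s) hbound htR hs0 htR
  have hsplit : expSum a = fun s : ℝ => a 0 +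
      ∑' k : ℕ, a (k + 1) * (s : 𝕜) ^ (k + 1) / ((k + 1).factorial : 𝕜) := by
    funext s
    unfold expSum
    rw [(ha.summable_expSum s).tsum_eq_zero_add]
    simp
  rw [hsplit]
  exact key.const_add _

theorem GeomBdd.continuous_expSum {a : ℕ → 𝕜} (ha : GeomBdd a) : Continuous (expSum a) :=
  continuous_iff_continuousAt.mpr fun t => (ha.hasDerivAt_expSum t).continuousAt

end ExpSum

theorem impulse_eq_expSum (G : RatFunc ℝ) (t : ℝ) :
    impulse G t = expSum (fun k => PowerSeries.coeff (k + 1) (expansion G)) t := rfl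

theorem continuous_impulse (G : RatFunc ℝ) : Continuous (impulse G) :=
  (geomBdd_expansion G).shift.continuous_expSum

/-! ### The Volterra operator and its power series -/

section Volterra

/-- Continuous functions on `[0, T]`, with the sup norm. -/
def Sig (T : ℝ) : Type := C(Set.Icc (0 : ℝ) T, ℝ)

instance (T : ℝ) : NormedAddCommGroup (Sig T) :=
  inferInstanceAs (NormedAddCommGroup C(Set.Icc (0 : ℝ) T, ℝ))

instance (T : ℝ) : NormedSpace ℝ (Sig T) :=
  inferInstanceAs (NormedSpace ℝ C(Set.Icc (0 : ℝ) T, ℝ))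

instance (T : ℝ) : CompleteSpace (Sig T) :=
  inferInstanceAs (CompleteSpace C(Set.Icc (0 : ℝ) T, ℝ))

instance (T : ℝ) : FunLike (Sig T) (Set.Icc (0 : ℝ) T) ℝ :=
  inferInstanceAs (FunLike C(Set.Icc (0 : ℝ) T, ℝ) (Set.Icc (0 : ℝ) T) ℝ)

namespace Sig

variable {T : ℝ}

@[ext]
theorem ext {v w : Sig T} (h : ∀ t, v t = w t) : v = w := ContinuousMap.ext h

protected theorem continuous (v : Sig T) : Continuous v := ContinuousMap.continuous v

@[simp] theorem add_apply (v w : Sig T) (t : Set.Icc (0 : ℝ) T) : (v + w) t = v t + w t := rfl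

@[simp] theorem sub_apply (v w : Sig T) (t : Set.Icc (0 : ℝ) T) : (v - w) t = v t - w t := rfl

@[simp] theorem smul_apply (c : ℝ) (v : Sig T) (t : Set.Icc (0 : ℝ) T) :
    (c • v) t = c * v t := rfl

@[simp] theorem sum_apply {ι : Type*} (s : Finset ι) (v : ι → Sig T) (t : Set.Icc (0 : ℝ) T) :
    (∑ i ∈ s, v i) t = ∑ i ∈ s, v i t :=
  ContinuousMap.sum_apply s v t

theorem norm_coe_le_norm (v : Sig T) (t : Set.Icc (0 : ℝ) T) : ‖v t‖ ≤ ‖v‖ :=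
  ContinuousMap.norm_coe_le_norm v t

theorem norm_le (v : Sig T) {M : ℝ} (hM : 0 ≤ M) : ‖v‖ ≤ M ↔ ∀ t, ‖v t‖ ≤ M :=
  ContinuousMap.norm_le v hM

/-- Evaluation at a point. -/
def eval (t : Set.Icc (0 : ℝ) T) : Sig T →L[ℝ] ℝ :=
  LinearMap.mkContinuous
    { toFun := fun v => v t
      map_add' := fun _ _ => rfl
      map_smul' := fun _ _ => rfl }
    1 fun v => (v.norm_coe_le_norm t).trans_eq (one_mul _).symm

theorem eval_apply (t : Set.Icc (0 : ℝ) T) (v : Sig T) : eval t v = v t := rfl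

/-- The signal given by a function that is continuous on `[0, T]`. -/
def mk (v : ℝ → ℝ) (hv : ContinuousOn v (Set.Icc 0 T)) : Sig T :=
  (⟨(Set.Icc 0 T).domRestrict v, continuousOn_iff_continuous_domRestrict.mp hv⟩ :
    C(Set.Icc (0 : ℝ) T, ℝ))

@[simp] theorem mk_apply (v : ℝ → ℝ) (hv : ContinuousOn v (Set.Icc 0 T))
    (t : Set.Icc (0 : ℝ) T) : mk v hv t = v t := rfl

end Sig

variable {T : ℝ} (hT : 0 ≤ T)

/-- Integration from `0`, as an operator on continuous functions on `[0, T]`. -/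
def volterra : Sig T →L[ℝ] Sig T :=
  LinearMap.mkContinuous
    -- `projIcc` extends `v` by constants to a continuous function on the line; inside `[0, T]`
    -- nothing changes.
    { toFun := fun v => Sig.mk (fun t => ∫ s in (0 : ℝ)..t, v (Set.projIcc 0 T hT s)) <| by
        have h : Continuous fun s => v (Set.projIcc 0 T hT s) :=
          v.continuous.comp continuous_projIcc
        exact (intervalIntegral.continuous_primitive
          (fun a b => h.intervalIntegrable a b) 0).continuousOn
      map_add' := fun v w => by
        ext t
        have h : ∀ v : Sig T, Continuous fun s => v (Set.projIcc 0 T hT s) :=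
          fun v => v.continuous.comp continuous_projIcc
        simp only [Sig.add_apply, Sig.mk_apply]
        exact intervalIntegral.integral_add ((h v).intervalIntegrable _ _)
          ((h w).intervalIntegrable _ _)
      map_smul' := fun c v => by
        ext t
        simp }
    T fun v => by
      rw [Sig.norm_le _ (by positivity)]
      intro t
      have := intervalIntegral.norm_integral_le_of_norm_le_const (a := 0) (b := (t : ℝ))
        (f := fun s => v (Set.projIcc 0 T hT s)) (C := ‖v‖) fun s _ => v.norm_coe_le_norm _
      refine this.trans ?_
      rw [sub_zero, abs_of_nonneg t.2.1, mul_comm]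
      exact mul_le_mul_of_nonneg_right t.2.2 (norm_nonneg v)

theorem volterra_apply (v : Sig T) (t : Set.Icc (0 : ℝ) T) :
    volterra hT v t = ∫ s in (0 : ℝ)..t, v (Set.projIcc 0 T hT s) := rfl

/-- Each integration turns `sᵏ / k!` into `sᵏ⁺¹ / (k + 1)!`. This factorial decay is what makes `∑
fₖ Jᵏ` converge for every geometrically bounded `f` and every `T`. -/
theorem abs_volterra_pow_apply_le (v : Sig T) (k : ℕ)
    (t : Set.Icc (0 : ℝ) T) :
    |(volterra hT ^ k) v t| ≤ ‖v‖ * ((t : ℝ) ^ k / k.factorial) := by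
  induction k generalizing t with
  | zero => simpa using v.norm_coe_le_norm t
  | succ k ih =>
    have ht := t.2.1
    rw [pow_succ', mul_apply_eq_comp, volterra_apply]
    have hint : ∫ s in (0 : ℝ)..t, ‖v‖ * (s ^ k / k.factorial) =
        ‖v‖ * ((t : ℝ) ^ (k + 1) / (k + 1).factorial) := by
      rw [intervalIntegral.integral_const_mul, intervalIntegral.integral_div, integral_pow,
        Nat.factorial_succ]
      push_cast
      have hk' : ((k.factorial : ℕ) : ℝ) ≠ 0 := by exact_mod_cast Nat.factorial_ne_zero k
      field_simp
      simp
    rw [← hint]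
    refine intervalIntegral.norm_integral_le_of_norm_le (E := ℝ)
      (g := fun s => ‖v‖ * (s ^ k / k.factorial)) ht ?_ ?_
    · refine Filter.Eventually.of_forall fun s hs => ?_
      have hs' : s ∈ Set.Icc (0 : ℝ) T := ⟨hs.1.le, hs.2.trans t.2.2⟩
      rw [Set.projIcc_of_mem hT hs']
      exact ih ⟨s, hs'⟩
    · exact Continuous.intervalIntegrable (by fun_prop) _ _

theorem norm_volterra_pow_le (k : ℕ) : ‖volterra hT ^ k‖ ≤ T ^ k / k.factorial := by
  refine ContinuousLinearMap.opNorm_le_bound _ (by positivity) fun v => ?_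
  rw [Sig.norm_le _ (by positivity)]
  intro t
  refine (abs_volterra_pow_apply_le hT v k t).trans ?_
  rw [mul_comm]
  have := t.2.1
  have := t.2.2
  gcongr

/-- Cauchy's formula for repeated integration. One `J` is peeled off on the inside and integrated by
parts against `-(t - s)ᵏ⁺¹ / (k + 1)!`; the boundary terms vanish, one factor at `s = t` and the
other at `s = 0`. -/
theorem volterra_pow_succ_apply (v : Sig T) (k : ℕ) (t : Set.Icc (0 : ℝ) T) :
    (volterra hT ^ (k + 1)) v t =
      ∫ s in (0 : ℝ)..t, ((t : ℝ) - s) ^ k / k.factorial * v (Set.projIcc 0 T hT s) := by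
  induction k generalizing v with
  | zero => simp [volterra_apply]
  | succ k ih =>
    rw [pow_succ, mul_apply_eq_comp, ih]
    have hv : Continuous fun s => v (Set.projIcc 0 T hT s) :=
      v.continuous.comp continuous_projIcc
    have hV : ∀ s ∈ Set.uIcc (0 : ℝ) t, HasDerivAt
        (fun s : ℝ => ∫ τ in (0 : ℝ)..s, v (Set.projIcc 0 T hT τ)) (v (Set.projIcc 0 T hT s)) s :=
      fun s _ => intervalIntegral.integral_hasDerivAt_right (hv.intervalIntegrable _ _)
        (hv.stronglyMeasurableAtFilter _ _) hv.continuousAt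
    have hW : ∀ s ∈ Set.uIcc (0 : ℝ) t, HasDerivAt
        (fun s : ℝ => -(((t : ℝ) - s) ^ (k + 1) / (k + 1).factorial))
        (((t : ℝ) - s) ^ k / k.factorial) s := by
      intro s _
      have h1 := (((((hasDerivAt_id s).const_sub (t : ℝ)).pow (k + 1)).div_const
        ((k + 1).factorial : ℝ))).neg
      refine h1.congr_deriv ?_
      have hk' : ((k.factorial : ℕ) : ℝ) ≠ 0 := by exact_mod_cast Nat.factorial_ne_zero k
      rw [Nat.factorial_succ]
      push_cast
      simp only [id]
      have hk : ((k : ℝ) + 1) ≠ 0 := by positivity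
      field_simp
    have key := intervalIntegral.integral_mul_deriv_eq_deriv_mul hV hW
      (hv.intervalIntegrable _ _) (Continuous.intervalIntegrable (by fun_prop) _ _)
    have e1 : ∫ s in (0 : ℝ)..t, ((t : ℝ) - s) ^ k / k.factorial *
        volterra hT v (Set.projIcc 0 T hT s) = ∫ s in (0 : ℝ)..t,
        (∫ τ in (0 : ℝ)..s, v (Set.projIcc 0 T hT τ)) * (((t : ℝ) - s) ^ k / k.factorial) := by
      refine intervalIntegral.integral_congr fun s hs => ?_
      rw [Set.uIcc_of_le t.2.1] at hs
      have hs' : s ∈ Set.Icc (0 : ℝ) T := ⟨hs.1, hs.2.trans t.2.2⟩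
      simp only [volterra_apply]
      rw [Set.projIcc_of_mem hT hs', mul_comm]
    rw [e1, key]
    simp only [sub_self, ne_eq, Nat.add_eq_zero_iff, one_ne_zero, and_false, not_false_eq_true,
      zero_pow, zero_div, neg_zero, mul_zero, intervalIntegral.integral_same, zero_mul, zero_sub,
      mul_neg, intervalIntegral.integral_neg, neg_neg]
    exact intervalIntegral.integral_congr fun s _ => mul_comm _ _

/-- The operator `∑ₖ fₖ Jᵏ`, where `J` is integration from `0`. -/
def volterraSeries (f : PowerSeries ℝ) : Sig T →L[ℝ] Sig T :=
  ∑' k : ℕ, PowerSeries.coeff k f • volterra hT ^ k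

variable {f g : PowerSeries ℝ}

theorem summable_volterraSeries (hf : GeomBdd fun k => PowerSeries.coeff k f) :
    Summable fun k : ℕ => ‖PowerSeries.coeff k f • volterra hT ^ k‖ := by
  obtain ⟨M, ρ, hM, hρ, h⟩ := hf
  refine Summable.of_nonneg_of_le (fun _ => norm_nonneg _) (fun k => ?_)
    ((Real.summable_pow_div_factorial (ρ * T)).mul_left M)
  rw [norm_smul, mul_pow]
  calc _ ≤ (M * ρ ^ k) * (T ^ k / k.factorial) :=
        mul_le_mul (h k) (norm_volterra_pow_le hT k) (norm_nonneg _) (by positivity)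
    _ = _ := by ring

theorem volterraSeries_add (hf : GeomBdd fun k => PowerSeries.coeff k f)
    (hg : GeomBdd fun k => PowerSeries.coeff k g) :
    volterraSeries hT (f + g) = volterraSeries hT f + volterraSeries hT g := by
  unfold volterraSeries
  rw [← (summable_volterraSeries hT hf).of_norm.tsum_add (summable_volterraSeries hT hg).of_norm]
  refine tsum_congr fun k => ?_
  rw [map_add, add_smul]

/-- The Cauchy product of two absolutely convergent series in a Banach algebra; since `JⁱJʲ = Jⁱ⁺ʲ`,
its terms are the coefficients of the product power series. -/
theorem volterraSeries_mul (hf : GeomBdd fun k => PowerSeries.coeff k f)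
    (hg : GeomBdd fun k => PowerSeries.coeff k g) :
    volterraSeries hT (f * g) = volterraSeries hT f * volterraSeries hT g := by
  unfold volterraSeries
  rw [tsum_mul_tsum_eq_tsum_sum_antidiagonal_of_summable_norm (summable_volterraSeries hT hf)
    (summable_volterraSeries hT hg)]
  refine tsum_congr fun k => ?_
  rw [PowerSeries.coeff_mul, Finset.sum_smul]
  refine Finset.sum_congr rfl fun p hp => ?_
  rw [smul_mul_smul_comm, ← pow_add, Finset.HasAntidiagonal.mem_antidiagonal.mp hp]

theorem volterraSeries_C (c : ℝ) : volterraSeries hT (PowerSeries.C c) = c • 1 := by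
  unfold volterraSeries
  rw [tsum_eq_single 0]
  · simp
  · intro k hk
    simp [PowerSeries.coeff_C, hk]

theorem volterraSeries_X : volterraSeries hT PowerSeries.X = volterra hT := by
  unfold volterraSeries
  rw [tsum_eq_single 1]
  · simp
  · intro k hk
    simp [PowerSeries.coeff_X, hk]

/-- The input-output operator, on `[0, T]`, of a proper transfer function. -/
def ioOp (G : RatFunc ℝ) : Sig T →L[ℝ] Sig T :=
  volterraSeries hT (expansion G)

theorem ioOp_add {G H : RatFunc ℝ} (hG : Proper G) (hH : Proper H) :
    ioOp hT (G + H) = ioOp hT G + ioOp hT H := by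
  unfold ioOp
  rw [expansion_add hG hH, volterraSeries_add hT (geomBdd_expansion G) (geomBdd_expansion H)]

theorem ioOp_mul {G H : RatFunc ℝ} (hG : Proper G) (hH : Proper H) :
    ioOp hT (G * H) = ioOp hT G * ioOp hT H := by
  unfold ioOp
  rw [expansion_mul hG hH, volterraSeries_mul hT (geomBdd_expansion G) (geomBdd_expansion H)]

theorem ioOp_C (c : ℝ) : ioOp hT (RatFunc.C c) = c • 1 := by
  unfold ioOp
  rw [expansion_C, volterraSeries_C]

theorem ioOp_zero : ioOp hT 0 = 0 := by
  simpa using ioOp_C hT 0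

theorem ioOp_one : ioOp hT 1 = 1 := by
  simpa using ioOp_C hT 1

theorem ioOp_inv_X : ioOp hT (RatFunc.X : RatFunc ℝ)⁻¹ = volterra hT := by
  unfold ioOp
  rw [expansion_inv_X, volterraSeries_X]

theorem ioOp_neg {G : RatFunc ℝ} (hG : Proper G) : ioOp hT (-G) = -ioOp hT G := by
  have h := ioOp_add hT hG.neg hG
  rw [neg_add_cancel, ioOp_zero] at h
  exact eq_neg_of_add_eq_zero_left h.symm

theorem ioOp_sub {G H : RatFunc ℝ} (hG : Proper G) (hH : Proper H) :
    ioOp hT (G - H) = ioOp hT G - ioOp hT H := by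
  rw [sub_eq_add_neg, ioOp_add hT hG hH.neg, ioOp_neg hT hH, sub_eq_add_neg]

theorem ioOp_sum {ι : Type*} (s : Finset ι) {G : ι → RatFunc ℝ} (h : ∀ i ∈ s, Proper (G i)) :
    ioOp hT (∑ i ∈ s, G i) = ∑ i ∈ s, ioOp hT (G i) := by
  classical
  induction s using Finset.induction_on with
  | empty => simpa using ioOp_zero hT
  | insert i s hi ih =>
    have hs : ∀ j ∈ s, Proper (G j) := fun j hj => h j (Finset.mem_insert_of_mem hj)
    rw [Finset.sum_insert hi, Finset.sum_insert hi,
      ioOp_add hT (h i (Finset.mem_insert_self i s)) (Proper.sum s hs), ih hs]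

/-- The bridge between the operator calculus and convolution: the term `k = 0` is the feedthrough,
and by Cauchy's formula the other terms sum, under dominated convergence, to convolution with the
impulse response. -/
theorem ioOp_apply (G : RatFunc ℝ) {v : ℝ → ℝ} (w : Sig T)
    (hw : ∀ t, w t = v t) (t : Set.Icc (0 : ℝ) T) : ioOp hT G w t = response G v t := by
  have hsum := (summable_volterraSeries hT (geomBdd_expansion G)).of_norm.hasSum
  have h1 := ((Sig.eval t).comp
    (ContinuousLinearMap.apply ℝ (Sig T) w)).hasSum hsum
  have h2 : HasSum (fun k : ℕ => PowerSeries.coeff k (expansion G) * (volterra hT ^ k) w t)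
      (ioOp hT G w t) := by
    simpa [ioOp, volterraSeries, Function.comp_def, Sig.eval_apply] using h1
  rw [← hasSum_nat_add_iff' 1] at h2
  simp only [Finset.range_one, Finset.sum_singleton, pow_zero,
    one_apply_eq_self] at h2
  have hwc : Continuous fun s => w (Set.projIcc 0 T hT s) := w.continuous.comp continuous_projIcc
  obtain ⟨M, ρ, hM, hρ, hb⟩ := (geomBdd_expansion G).shift
  have h3 : HasSum (fun k : ℕ => ∫ s in (0 : ℝ)..t, PowerSeries.coeff (k + 1) (expansion G) *
      ((t : ℝ) - s) ^ k / k.factorial * w (Set.projIcc 0 T hT s))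
      (∫ s in (0 : ℝ)..t, impulse G (t - s) * w (Set.projIcc 0 T hT s)) := by
    refine intervalIntegral.hasSum_integral_of_dominated_convergence
      (fun k _ => M * ((ρ * T) ^ k / k.factorial) * ‖w‖) (fun k => ?_) (fun k => ?_) ?_ ?_ ?_
    · refine Continuous.aestronglyMeasurable (Continuous.mul ?_ hwc)
      fun_prop
    · refine Filter.Eventually.of_forall fun s hs => ?_
      rw [Set.uIoc_of_le t.2.1] at hs
      rw [norm_mul]
      refine mul_le_mul ?_ (w.norm_coe_le_norm _) (norm_nonneg _) (by positivity)
      refine norm_expSum_term_le (𝕜 := ℝ) hb (t := t - s) ?_ k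
      have := t.2.2
      rw [abs_of_nonneg (by linarith [hs.2])]
      linarith [hs.1]
    · exact Filter.Eventually.of_forall fun s _ =>
        ((Real.summable_pow_div_factorial (ρ * T)).mul_left M).mul_right _
    · exact intervalIntegrable_const
    · refine Filter.Eventually.of_forall fun s _ => ?_
      exact ((geomBdd_expansion G).shift.summable_expSum (t - s)).hasSum.mul_right _
  have h4 := h2.unique (a₂ := ∫ s in (0 : ℝ)..t, impulse G (t - s) * w (Set.projIcc 0 T hT s)) <| by
    refine h3.congr_fun fun k => ?_
    rw [volterra_pow_succ_apply, ← intervalIntegral.integral_const_mul]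
    refine intervalIntegral.integral_congr fun s _ => ?_
    ring
  rw [sub_eq_iff_eq_add] at h4
  rw [h4, add_comm, response, feedthrough, hw]
  congr 1
  refine intervalIntegral.integral_congr fun s hs => ?_
  rw [Set.uIcc_of_le t.2.1] at hs
  have hs' : s ∈ Set.Icc (0 : ℝ) T := ⟨hs.1, hs.2.trans t.2.2⟩
  rw [Set.projIcc_of_mem hT hs', hw]

end Volterra

/-! ### Exponential decay -/

/-- Exponential decay on `[0, ∞)`. -/
def ExpDecay {E : Type*} [Norm E] (h : ℝ → E) : Prop :=
  ∃ C ε : ℝ, 0 < ε ∧ ∀ t, 0 ≤ t → ‖h t‖ ≤ C * Real.exp (-ε * t)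

/-- The integrating factor `exp(-l t)` leaves a function with derivative `exp(-l t) g t`, of norm at
most `C exp((μ - ε) t)`, where `μ = -Re l`. -/
theorem ExpDecay.of_hasDerivAt {h g : ℝ → ℂ} {l : ℂ} (hl : l.re < 0) (hg : ExpDecay g)
    (hh : ∀ t, HasDerivAt h (l * h t + g t) t) : ExpDecay h := by
  obtain ⟨C, ε, hε, hC⟩ := hg
  have hC0 : 0 ≤ C := by simpa using (norm_nonneg _).trans (hC 0 le_rfl)
  set μ := -l.re with hμ
  have hμ0 : 0 < μ := by linarith
  -- The rate is taken strictly below both `ε` and `μ`, so that the resonant case `ε = μ` needs no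
  -- separate treatment.
  set δ := min ε μ / 2 with hδ
  have hm : 0 < min ε μ := lt_min hε hμ0
  have hδ0 : 0 < δ := by positivity
  have hδε : δ < ε := by linarith [min_le_left ε μ]
  have hδμ : δ < μ := by linarith [min_le_right ε μ]
  have hexp : ∀ t : ℝ, HasDerivAt (fun t : ℝ => Complex.exp (-l * t)) (-l * Complex.exp (-l * t)) t := by
    intro t
    have h1 : HasDerivAt (fun t : ℝ => -l * (t : ℂ)) (-l) t := by
      simpa using (Complex.ofRealCLM.hasDerivAt (x := t)).const_mul (-l)
    simpa [mul_comm] using h1.cexp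
  have hk : ∀ t : ℝ, HasDerivAt (fun t : ℝ => Complex.exp (-l * t) * h t)
      (Complex.exp (-l * t) * g t) t := by
    intro t
    refine ((hexp t).mul (hh t)).congr_deriv ?_
    ring
  have hnexp : ∀ t : ℝ, ‖Complex.exp (-l * t)‖ = Real.exp (μ * t) := by
    intro t
    rw [Complex.norm_exp]
    simp [hμ]
  have hB : ∀ t : ℝ, HasDerivAt
      (fun t : ℝ => ‖h 0‖ + C / (μ - δ) * Real.exp ((μ - δ) * t)) (C * Real.exp ((μ - δ) * t)) t := by
    intro t
    have h1 : HasDerivAt (fun t : ℝ => (μ - δ) * t) (μ - δ) t := by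
      simpa using (hasDerivAt_id t).const_mul (μ - δ)
    refine ((h1.exp.const_mul (C / (μ - δ))).const_add ‖h 0‖).congr_deriv ?_
    have : μ - δ ≠ 0 := by linarith
    field_simp
  have hμδ : 0 < μ - δ := by linarith
  refine ⟨‖h 0‖ + C / (μ - δ), δ, hδ0, fun t ht => ?_⟩
  have key := image_norm_le_of_norm_deriv_right_le_deriv_boundary (a := 0) (b := t)
    (f := fun t : ℝ => Complex.exp (-l * t) * h t)
    (f' := fun t : ℝ => Complex.exp (-l * t) * g t)
    (fun s _ => (hk s).continuousAt.continuousWithinAt) (fun s _ => (hk s).hasDerivWithinAt)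
    (B := fun t : ℝ => ‖h 0‖ + C / (μ - δ) * Real.exp ((μ - δ) * t))
    (by simp; positivity) hB ?_ (Set.right_mem_Icc.mpr ht)
  · rw [norm_mul, hnexp] at key
    have hpos := Real.exp_pos (μ * t)
    have h2 : ‖h t‖ = Real.exp (-(μ * t)) * (Real.exp (μ * t) * ‖h t‖) := by
      rw [← mul_assoc, ← Real.exp_add]; simp
    rw [h2]
    calc _ ≤ Real.exp (-(μ * t)) * (‖h 0‖ + C / (μ - δ) * Real.exp ((μ - δ) * t)) :=
          mul_le_mul_of_nonneg_left key (Real.exp_pos _).le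
      _ = ‖h 0‖ * Real.exp (-(μ * t)) + C / (μ - δ) * Real.exp (-δ * t) := by
          rw [mul_add, mul_left_comm, ← Real.exp_add]
          ring_nf
      _ ≤ ‖h 0‖ * Real.exp (-δ * t) + C / (μ - δ) * Real.exp (-δ * t) := by
          gcongr
          nlinarith
      _ = _ := by ring
  · intro s hs
    rw [norm_mul, hnexp]
    calc _ ≤ Real.exp (μ * s) * (C * Real.exp (-ε * s)) :=
          mul_le_mul_of_nonneg_left (hC s hs.1) (Real.exp_pos _).le
      _ = C * Real.exp ((μ - ε) * s) := by
          rw [mul_left_comm, ← Real.exp_add]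
          ring_nf
      _ ≤ C * Real.exp ((μ - δ) * s) := by
          have := hs.1
          gcongr

/-- The shift of sequences. -/
def shiftEnd : Module.End ℂ (ℕ → ℂ) where
  toFun a := fun k => a (k + 1)
  map_add' _ _ := rfl
  map_smul' _ _ := rfl

theorem shiftEnd_pow_apply (j : ℕ) (a : ℕ → ℂ) (k : ℕ) : (shiftEnd ^ j) a k = a (k + j) := by
  induction j generalizing a with
  | zero => simp
  | succ j ih =>
    rw [pow_succ, Module.End.mul_apply, ih]
    rfl

theorem aeval_shiftEnd_apply (q : ℂ[X]) (a : ℕ → ℂ) (k : ℕ) :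
    Polynomial.aeval shiftEnd q a k =
      ∑ j ∈ Finset.range (q.natDegree + 1), q.coeff j * a (k + j) := by
  rw [Polynomial.aeval_eq_sum_range]
  simp [LinearMap.sum_apply, Finset.sum_apply, shiftEnd_pow_apply]

/-- Induction on the degree. If `q = (X - l) q'`, the sequence `aₖ₊₁ - l aₖ` is annihilated by `q'`,
so its generating function `g` decays; that of `a` solves `h' = l h + g` and decays because `Re l <
0`. -/
theorem expDecay_expSum_of_aeval_eq_zero (n : ℕ) (q : ℂ[X]) (hn : q.natDegree = n) (hq : q ≠ 0)
    (hroots : ∀ z, q.IsRoot z → z.re < 0) (a : ℕ → ℂ) (ha : GeomBdd a)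
    (h : Polynomial.aeval shiftEnd q a = 0) : ExpDecay (expSum a) := by
  induction n generalizing q a with
  | zero =>
    rw [Polynomial.eq_C_of_natDegree_eq_zero hn] at h hq
    have hc : q.coeff 0 ≠ 0 := fun h0 => hq (by rw [h0, map_zero])
    rw [Polynomial.aeval_C] at h
    have ha0 : a = 0 := by
      have h' : q.coeff 0 • a = 0 := h
      exact (smul_eq_zero.mp h').resolve_left hc
    refine ⟨0, 1, one_pos, fun t _ => ?_⟩
    simp [ha0, expSum]
  | succ n ih =>
    obtain ⟨l, hl⟩ := IsAlgClosed.exists_root q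
      (by rw [Polynomial.degree_eq_natDegree hq, hn]; exact_mod_cast Nat.succ_ne_zero n)
    obtain ⟨q', rfl⟩ := Polynomial.dvd_iff_isRoot.mpr hl
    have hq' : q' ≠ 0 := right_ne_zero_of_mul hq
    rw [Polynomial.natDegree_mul (Polynomial.X_sub_C_ne_zero l) hq', Polynomial.natDegree_X_sub_C]
      at hn
    have hb : ExpDecay (expSum fun k => a (k + 1) - l * a k) := by
      refine ih q' (by omega) hq' (fun z hz => hroots z ?_) _ (ha.shift.sub (ha.const_mul l)) ?_
      · simp [Polynomial.IsRoot.def.mp hz]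
      · rw [mul_comm, map_mul, Module.End.mul_apply] at h
        convert h using 2
        ext k
        simp [shiftEnd]
    refine ExpDecay.of_hasDerivAt (hroots l hl) hb fun t => ?_
    refine (ha.hasDerivAt_expSum t).congr_deriv ?_
    rw [expSum_sub ha.shift (ha.const_mul l), expSum_const_mul]
    ring

theorem expDecay_expSum_of_recurrence {q : ℝ[X]} (hq : StablePoly q) {a : ℕ → ℝ} (ha : GeomBdd a)
    (h : ∀ k, ∑ j ∈ Finset.range (q.natDegree + 1), q.coeff j * a (k + j) = 0) :
    ExpDecay (expSum a) := by
  have hinj : Function.Injective (algebraMap ℝ ℂ) := (algebraMap ℝ ℂ).injective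
  have key : ExpDecay (expSum fun k => (a k : ℂ)) := by
    refine expDecay_expSum_of_aeval_eq_zero _ (q.map (algebraMap ℝ ℂ)) rfl
      ((Polynomial.map_ne_zero_iff hinj).mpr hq.1) (fun z hz => hq.2 z ?_) _ ?_ ?_
    · rwa [Polynomial.IsRoot.def, Polynomial.eval_map_algebraMap] at hz
    · obtain ⟨M, ρ, hM, hρ, hb⟩ := ha
      exact ⟨M, ρ, hM, hρ, fun k => by simpa using hb k⟩
    · ext k
      rw [aeval_shiftEnd_apply, Polynomial.natDegree_map]
      simp only [Polynomial.coeff_map, Complex.coe_algebraMap, Pi.zero_apply]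
      exact_mod_cast h k
  obtain ⟨C, ε, hε, hC⟩ := key
  refine ⟨C, ε, hε, fun t ht => ?_⟩
  have := hC t ht
  rwa [← expSum_ofReal, Complex.norm_real] at this

/-! ### The `L₁` gain bounds the response -/

theorem expDecay_impulse {G : RatFunc ℝ} (hG : Proper G) (hs : Stable G) :
    ExpDecay (impulse G) :=
  expDecay_expSum_of_recurrence hs (geomBdd_expansion G).shift
    (sum_denom_coeff_mul_expansion hG)

theorem integrableOn_abs_impulse {G : RatFunc ℝ} (hG : Proper G) (hs : Stable G) :
    MeasureTheory.IntegrableOn (fun t => |impulse G t|) (Set.Ioi 0) := by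
  obtain ⟨C, ε, hε, hC⟩ := expDecay_impulse hG hs
  refine MeasureTheory.Integrable.mono' ((exp_neg_integrableOn_Ioi 0 hε).const_mul C)
    (continuous_impulse G).abs.aestronglyMeasurable ?_
  refine (MeasureTheory.ae_restrict_iff' measurableSet_Ioi).mpr
    (Filter.Eventually.of_forall fun t ht => ?_)
  simpa using hC t (le_of_lt ht)

theorem l1Gain_nonneg (G : RatFunc ℝ) : 0 ≤ l1Gain G :=
  add_nonneg (abs_nonneg _) (MeasureTheory.integral_nonneg fun _ => abs_nonneg _)

/-- The input is bounded only on `[0, t]`: this causal form lets the small-gain argument run on a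
finite horizon, where a maximum is known to exist. -/
theorem abs_response_le {G : RatFunc ℝ} (hG : Proper G) (hs : Stable G) {v : ℝ → ℝ} {t M : ℝ}
    (ht : 0 ≤ t) (hv : ∀ s ∈ Set.Icc 0 t, |v s| ≤ M) : |response G v t| ≤ l1Gain G * M := by
  have hM : 0 ≤ M := (abs_nonneg _).trans (hv 0 ⟨le_rfl, ht⟩)
  have h1 : |∫ τ in (0 : ℝ)..t, impulse G (t - τ) * v τ| ≤
      ∫ τ in (0 : ℝ)..t, |impulse G (t - τ)| * M := by
    refine intervalIntegral.norm_integral_le_of_norm_le (E := ℝ) ht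
      (Filter.Eventually.of_forall fun s hs => ?_) ?_
    · rw [norm_mul]
      exact mul_le_mul_of_nonneg_left (hv s ⟨hs.1.le, hs.2⟩) (norm_nonneg _)
    · have := continuous_impulse G
      exact Continuous.intervalIntegrable (by fun_prop) _ _
  have h2 : ∫ τ in (0 : ℝ)..t, |impulse G (t - τ)| * M ≤
      (∫ τ in Set.Ioi (0 : ℝ), |impulse G τ|) * M := by
    rw [intervalIntegral.integral_mul_const,
      intervalIntegral.integral_comp_sub_left (fun τ => |impulse G τ|) t, sub_self, sub_zero,
      intervalIntegral.integral_of_le ht]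
    refine mul_le_mul_of_nonneg_right ?_ hM
    exact MeasureTheory.setIntegral_mono_set (integrableOn_abs_impulse hG hs)
      (Filter.Eventually.of_forall fun _ => abs_nonneg _)
      (Filter.Eventually.of_forall fun _ h => h.1)
  have h3 : |feedthrough G * v t| ≤ |feedthrough G| * M := by
    rw [abs_mul]
    exact mul_le_mul_of_nonneg_left (hv t ⟨ht, le_rfl⟩) (abs_nonneg _)
  unfold response l1Gain
  calc _ ≤ _ := abs_add_le _ _
    _ ≤ |feedthrough G| * M + (∫ τ in Set.Ioi (0 : ℝ), |impulse G τ|) * M :=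
        add_le_add h3 (h1.trans h2)
    _ = _ := by ring

/-! ### Closure properties of stable polynomials and transfer functions -/

theorem StablePoly.of_dvd {p q : ℝ[X]} (hq : StablePoly q) (h : p ∣ q) : StablePoly p := by
  obtain ⟨r, rfl⟩ := h
  exact ⟨left_ne_zero_of_mul hq.1, fun z hz => hq.2 z (by rw [map_mul, hz, zero_mul])⟩

theorem StablePoly.mul {p q : ℝ[X]} (hp : StablePoly p) (hq : StablePoly q) :
    StablePoly (p * q) := by
  refine ⟨mul_ne_zero hp.1 hq.1, fun z hz => ?_⟩
  rw [map_mul] at hz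
  exact (mul_eq_zero.mp hz).elim (hp.2 z) (hq.2 z)

theorem stable_div (p : ℝ[X]) {q : ℝ[X]} (hq : StablePoly q) :
    Stable (algebraMap ℝ[X] (RatFunc ℝ) p / algebraMap ℝ[X] (RatFunc ℝ) q) :=
  hq.of_dvd (RatFunc.denom_div_dvd p q)

theorem Stable.mul {G H : RatFunc ℝ} (hG : Stable G) (hH : Stable H) : Stable (G * H) :=
  (StablePoly.mul hG hH).of_dvd (RatFunc.denom_mul_dvd G H)

theorem Stable.add {G H : RatFunc ℝ} (hG : Stable G) (hH : Stable H) : Stable (G + H) :=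
  (StablePoly.mul hG hH).of_dvd (RatFunc.denom_add_dvd G H)

theorem stable_C (a : ℝ) : Stable (RatFunc.C a) := by
  unfold Stable
  rw [RatFunc.denom_C]
  exact ⟨one_ne_zero, fun z hz => by simp at hz⟩

theorem Stable.neg {G : RatFunc ℝ} (hG : Stable G) : Stable (-G) := by
  have := (stable_C (-1)).mul hG
  simpa using this

theorem Stable.sub {G H : RatFunc ℝ} (hG : Stable G) (hH : Stable H) : Stable (G - H) := by
  rw [sub_eq_add_neg]
  exact hG.add hH.neg

/-! ### The linear flow of a Hurwitz matrix and the Lyapunov equation -/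

section Flow

variable {n : ℕ} {A : Matrix (Fin n) (Fin n) ℝ}

theorem stablePoly_charpoly (hA : IsHurwitz A) : StablePoly A.charpoly := by
  refine ⟨A.charpoly_monic.ne_zero, fun z hz => hA z ?_⟩
  rw [Matrix.mem_spectrum_iff_isRoot_charpoly, Matrix.charpoly_map, Polynomial.IsRoot.def,
    Polynomial.eval_map_algebraMap]
  exact hz

theorem norm_mulVec_le (A : Matrix (Fin n) (Fin n) ℝ) (w : Fin n → ℝ) :
    ‖A *ᵥ w‖ ≤ (∑ i, ∑ j, |A i j|) * ‖w‖ := by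
  have h0 : ∀ i, 0 ≤ ∑ j, |A i j| := fun i => Finset.sum_nonneg fun _ _ => abs_nonneg _
  refine (pi_norm_le_iff_of_nonneg
    (mul_nonneg (Finset.sum_nonneg fun i _ => h0 i) (norm_nonneg _))).mpr fun i => ?_
  calc ‖∑ j, A i j * w j‖ ≤ ∑ j, ‖A i j * w j‖ := norm_sum_le _ _
    _ ≤ ∑ j, |A i j| * ‖w‖ := Finset.sum_le_sum fun j _ => by
        rw [norm_mul]
        exact mul_le_mul_of_nonneg_left (norm_le_pi_norm w j) (norm_nonneg _)
    _ = (∑ j, |A i j|) * ‖w‖ := by rw [Finset.sum_mul]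
    _ ≤ _ := mul_le_mul_of_nonneg_right
        (Finset.single_le_sum (f := fun i => ∑ j, |A i j|) (fun i _ => h0 i) (Finset.mem_univ i))
        (norm_nonneg _)

theorem geomBdd_pow_mulVec (A : Matrix (Fin n) (Fin n) ℝ) (w : Fin n → ℝ) (i : Fin n) :
    GeomBdd fun k => ((A ^ k) *ᵥ w) i := by
  have h0 : 0 ≤ ∑ i, ∑ j, |A i j| :=
    Finset.sum_nonneg fun _ _ => Finset.sum_nonneg fun _ _ => abs_nonneg _
  refine ⟨‖w‖, ∑ i, ∑ j, |A i j|, norm_nonneg _, h0, fun k => ?_⟩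
  refine (norm_le_pi_norm _ i).trans ?_
  induction k with
  | zero => simp
  | succ k ih =>
    rw [pow_succ', ← Matrix.mulVec_mulVec]
    calc _ ≤ _ := norm_mulVec_le A _
      _ ≤ _ := mul_le_mul_of_nonneg_left ih h0
      _ = _ := by ring

/-- The solution `exp (t A) w` of `x' = A x`, `x 0 = w`. -/
def flow (A : Matrix (Fin n) (Fin n) ℝ) (w : Fin n → ℝ) (t : ℝ) : Fin n → ℝ :=
  fun i => expSum (fun k => ((A ^ k) *ᵥ w) i) t

theorem flow_zero (A : Matrix (Fin n) (Fin n) ℝ) (w : Fin n → ℝ) : flow A w 0 = w := by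
  ext i
  simp [flow, expSum_zero_right]

theorem hasDerivAt_flow (A : Matrix (Fin n) (Fin n) ℝ) (w : Fin n → ℝ) (t : ℝ) :
    HasDerivAt (flow A w) (A *ᵥ flow A w t) t := by
  refine hasDerivAt_pi.mpr fun i => ?_
  refine ((geomBdd_pow_mulVec A w i).hasDerivAt_expSum t).congr_deriv ?_
  have h : (fun k => ((A ^ (k + 1)) *ᵥ w) i) = fun k => ∑ j, A i j * ((A ^ k) *ᵥ w) j := by
    funext k
    rw [pow_succ', ← Matrix.mulVec_mulVec]
    rfl
  rw [h, expSum_sum _ fun j _ => (geomBdd_pow_mulVec A w j).const_mul (A i j)]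
  simp only [expSum_const_mul]
  rfl

/-- By Cayley-Hamilton the Taylor coefficients `Aᵏ w` satisfy the recurrence given by the
characteristic polynomial, which is stable. -/
theorem tendsto_flow (hA : IsHurwitz A) (w : Fin n → ℝ) :
    Filter.Tendsto (flow A w) Filter.atTop (nhds 0) := by
  refine tendsto_pi_nhds.mpr fun i => ?_
  have hdec : ExpDecay fun t => flow A w t i := by
    refine expDecay_expSum_of_recurrence (stablePoly_charpoly hA) (geomBdd_pow_mulVec A w i)
      fun k => ?_
    have hCH := A.aeval_self_charpoly
    rw [Polynomial.aeval_eq_sum_range] at hCH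
    have h1 := congrFun (congrArg (fun M => (A ^ k * M) *ᵥ w) hCH) i
    simp only [mul_zero, Matrix.zero_mulVec, Pi.zero_apply, Finset.mul_sum, Matrix.sum_mulVec,
      Finset.sum_apply, Matrix.mul_smul, Matrix.smul_mulVec, Pi.smul_apply, smul_eq_mul,
      ← pow_add] at h1
    exact h1
  obtain ⟨C, ε, hε, hC⟩ := hdec
  have hlim : Filter.Tendsto (fun t => C * Real.exp (-ε * t)) Filter.atTop (nhds 0) := by
    have h1 : Filter.Tendsto (fun t => ε * t) Filter.atTop Filter.atTop :=
      Filter.tendsto_id.const_mul_atTop hε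
    have h2 := (Real.tendsto_exp_neg_atTop_nhds_zero.comp h1).const_mul C
    simpa [Function.comp_def] using h2
  refine squeeze_zero_norm' ?_ hlim
  filter_upwards [Filter.eventually_ge_atTop 0] with t ht using hC t ht

theorem hasDerivWithinAt_dotProduct {x y : ℝ → Fin n → ℝ} {x' y' : Fin n → ℝ} {s : Set ℝ}
    {t : ℝ} (hx : HasDerivWithinAt x x' s t) (hy : HasDerivWithinAt y y' s t) :
    HasDerivWithinAt (fun t => x t ⬝ᵥ y t) (x' ⬝ᵥ y t + x t ⬝ᵥ y') s t := by
  have h := HasDerivWithinAt.fun_sum (u := Finset.univ) fun i _ =>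
    (hasDerivWithinAt_pi.mp hx i).mul (hasDerivWithinAt_pi.mp hy i)
  refine h.congr_deriv ?_
  simp [_root_.dotProduct, Finset.sum_add_distrib]

theorem hasDerivWithinAt_mulVec (M : Matrix (Fin n) (Fin n) ℝ) {y : ℝ → Fin n → ℝ}
    {y' : Fin n → ℝ} {s : Set ℝ} {t : ℝ} (hy : HasDerivWithinAt y y' s t) :
    HasDerivWithinAt (fun t => M *ᵥ y t) (M *ᵥ y') s t := by
  refine hasDerivWithinAt_pi.mpr fun i => ?_
  refine (hasDerivWithinAt_dotProduct (hasDerivWithinAt_const t s (M i)) hy).congr_deriv ?_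
  simp [Matrix.mulVec]

theorem hasDerivAt_flow_form (M : Matrix (Fin n) (Fin n) ℝ) (v w : Fin n → ℝ) (t : ℝ) :
    HasDerivAt (fun t => flow A v t ⬝ᵥ (M *ᵥ flow A w t))
      (flow A v t ⬝ᵥ ((Aᵀ * M + M * A) *ᵥ flow A w t)) t := by
  have hv := (hasDerivAt_flow A v t).hasDerivWithinAt (s := Set.univ)
  have hw := (hasDerivAt_flow A w t).hasDerivWithinAt (s := Set.univ)
  rw [← hasDerivWithinAt_univ]
  refine (hasDerivWithinAt_dotProduct hv (hasDerivWithinAt_mulVec M hw)).congr_deriv ?_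
  rw [Matrix.add_mulVec, dotProduct_add, ← Matrix.mulVec_mulVec, ← Matrix.mulVec_mulVec,
    Matrix.dotProduct_mulVec _ Aᵀ, Matrix.vecMul_transpose]

theorem tendsto_flow_form (hA : IsHurwitz A) (M : Matrix (Fin n) (Fin n) ℝ) (v w : Fin n → ℝ) :
    Filter.Tendsto (fun t => flow A v t ⬝ᵥ (M *ᵥ flow A w t)) Filter.atTop (nhds 0) := by
  have hc : Continuous fun p : (Fin n → ℝ) × (Fin n → ℝ) => p.1 ⬝ᵥ (M *ᵥ p.2) := by fun_prop
  have h := (hc.tendsto (0, 0)).comp ((tendsto_flow hA v).prodMk_nhds (tendsto_flow hA w))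
  simpa [Function.comp_def] using h

variable {P Q : Matrix (Fin n) (Fin n) ℝ}

/-- `D = Pᵀ - P` solves the homogeneous Lyapunov equation, so the bilinear form of `D` is constant
along pairs of trajectories; these tend to zero, hence `D = 0`. -/
theorem lyapunov_isSymm (hA : IsHurwitz A) (hQ : Qᵀ = Q) (hP : Aᵀ * P + P * A = -Q) :
    Pᵀ = P := by
  have hD : Aᵀ * (Pᵀ - P) + (Pᵀ - P) * A = 0 := by
    have h1 := congrArg Matrix.transpose hP
    simp only [Matrix.transpose_add, Matrix.transpose_mul, Matrix.transpose_transpose,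
      Matrix.transpose_neg, hQ] at h1
    rw [mul_sub, sub_mul]
    calc _ = (Pᵀ * A + Aᵀ * Pᵀ) - (Aᵀ * P + P * A) := by abel
      _ = 0 := by rw [h1, hP, sub_self]
  have hform : ∀ v w : Fin n → ℝ, v ⬝ᵥ ((Pᵀ - P) *ᵥ w) = 0 := by
    intro v w
    have hd := fun t => hasDerivAt_flow_form (A := A) (Pᵀ - P) v w t
    simp only [hD, Matrix.zero_mulVec, dotProduct_zero] at hd
    have hconst := fun t => is_const_of_deriv_eq_zero (fun t => (hd t).differentiableAt)
      (fun t => (hd t).deriv) t 0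
    have hlim := tendsto_flow_form hA (Pᵀ - P) v w
    simp only [hconst, flow_zero] at hlim
    exact tendsto_nhds_unique tendsto_const_nhds hlim
  rw [← sub_eq_zero]
  ext i j
  simpa using hform (Pi.single i 1) (Pi.single j 1)

/-- The form of `P` is nonincreasing along the flow, with derivative minus the form of `Q`, and its
limit is zero. -/
theorem lyapunov_nonneg (hA : IsHurwitz A) (hQ : Q.PosDef) (hP : Aᵀ * P + P * A = -Q)
    (w : Fin n → ℝ) : 0 ≤ w ⬝ᵥ (P *ᵥ w) := by
  have hd := fun t => hasDerivAt_flow_form (A := A) P w w t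
  have hanti : Antitone fun t => flow A w t ⬝ᵥ (P *ᵥ flow A w t) := by
    refine antitone_of_deriv_nonpos (fun t => (hd t).differentiableAt) fun t => ?_
    rw [(hd t).deriv, hP, Matrix.neg_mulVec, dotProduct_neg]
    have := hQ.posSemidef.dotProduct_mulVec_nonneg (flow A w t)
    simp only [star_trivial] at this
    linarith
  have := hanti.le_of_tendsto (tendsto_flow_form hA P w w) 0
  simpa [flow_zero] using this

theorem lyapunov_posDef (hA : IsHurwitz A) (hQ : Q.PosDef) (hP : Aᵀ * P + P * A = -Q) :
    P.PosDef := by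
  have hQT : Qᵀ = Q := by simpa using hQ.isHermitian.eq
  refine Matrix.PosDef.of_dotProduct_mulVec_pos ?_ fun w hw => ?_
  · simpa [Matrix.IsHermitian] using lyapunov_isSymm hA hQT hP
  rw [star_trivial]
  refine lt_of_le_of_ne (lyapunov_nonneg hA hQ hP w) fun h0 => ?_
  -- If `wᵀP w = 0`, the nonnegative form is minimal at time `0` along the trajectory through `w`;
  -- its derivative `-wᵀQ w` would vanish there.
  have hmin : IsLocalMin (fun t => flow A w t ⬝ᵥ (P *ᵥ flow A w t)) 0 := by
    refine Filter.Eventually.of_forall fun t => ?_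
    simp only [flow_zero, ← h0]
    exact lyapunov_nonneg hA hQ hP _
  have hz := hmin.hasDerivAt_eq_zero (hasDerivAt_flow_form (A := A) P w w 0)
  rw [hP, flow_zero, Matrix.neg_mulVec, dotProduct_neg] at hz
  have := hQ.dotProduct_mulVec_pos hw
  simp only [star_trivial] at this
  linarith

/-! ### Extreme eigenvalues and quadratic forms -/

theorem lamMin_mul_le {M : Matrix (Fin n) (Fin n) ℝ} (hM : M.IsHermitian) (x : Fin n → ℝ) :
    lamMin M * (x ⬝ᵥ x) ≤ x ⬝ᵥ (M *ᵥ x) := by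
  have hfin : (spectrum ℝ M).Finite := M.finite_spectrum
  have hH : (M - algebraMap ℝ (Matrix (Fin n) (Fin n) ℝ) (lamMin M)).IsHermitian := by
    refine hM.sub ?_
    rw [Matrix.algebraMap_eq_diagonal]
    exact Matrix.isHermitian_diagonal _
  have hpsd := hH.posSemidef_iff_eigenvalues_nonneg.mpr fun i => by
    have h1 := hH.eigenvalues_mem_spectrum_real i
    rw [← spectrum.sub_singleton_eq] at h1
    obtain ⟨μ, hμ, c, hc, h⟩ := Set.mem_sub.mp h1
    rw [Set.mem_singleton_iff] at hc
    rw [← h, hc, Pi.zero_apply, sub_nonneg]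
    exact csInf_le hfin.bddBelow hμ
  have h2 := hpsd.dotProduct_mulVec_nonneg x
  rw [star_trivial, Matrix.sub_mulVec, dotProduct_sub, Algebra.algebraMap_eq_smul_one,
    Matrix.smul_mulVec, Matrix.one_mulVec, dotProduct_smul, smul_eq_mul] at h2
  linarith

theorem le_lamMax_mul {M : Matrix (Fin n) (Fin n) ℝ} (hM : M.IsHermitian) (x : Fin n → ℝ) :
    x ⬝ᵥ (M *ᵥ x) ≤ lamMax M * (x ⬝ᵥ x) := by
  have h := lamMin_mul_le hM.neg x
  have hneg : lamMin (-M) = -lamMax M := by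
    unfold lamMin lamMax
    rw [← spectrum.neg_eq, Real.sInf_def, neg_neg]
  rw [hneg, Matrix.neg_mulVec, dotProduct_neg] at h
  linarith

theorem pos_of_mem_spectrum_of_posDef {M : Matrix (Fin n) (Fin n) ℝ} (hM : M.PosDef) {μ : ℝ}
    (hμ : μ ∈ spectrum ℝ M) : 0 < μ := by
  rw [hM.isHermitian.spectrum_real_eq_range_eigenvalues] at hμ
  obtain ⟨i, rfl⟩ := hμ
  exact hM.eigenvalues_pos i

theorem spectrum_nonempty_of_isHermitian (hn : 0 < n) {M : Matrix (Fin n) (Fin n) ℝ}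
    (hM : M.IsHermitian) : (spectrum ℝ M).Nonempty :=
  ⟨_, hM.eigenvalues_mem_spectrum_real ⟨0, hn⟩⟩

theorem lamMin_pos (hn : 0 < n) {M : Matrix (Fin n) (Fin n) ℝ} (hM : M.PosDef) : 0 < lamMin M :=
  pos_of_mem_spectrum_of_posDef hM
    ((spectrum_nonempty_of_isHermitian hn hM.isHermitian).csInf_mem M.finite_spectrum)

theorem lamMax_pos (hn : 0 < n) {M : Matrix (Fin n) (Fin n) ℝ} (hM : M.PosDef) : 0 < lamMax M :=
  pos_of_mem_spectrum_of_posDef hM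
    ((spectrum_nonempty_of_isHermitian hn hM.isHermitian).csSup_mem M.finite_spectrum)

end Flow

/-! ### The resolvent of a matrix -/

section StateSpace

variable {n : ℕ} (A : Matrix (Fin n) (Fin n) ℝ)

/-- A cofactor of `X I - A` is the determinant of `X B + B'` with `B` the identity having one row
zeroed, so its coefficient of degree `n` is `det B = 0`. -/
theorem natDegree_adjugate_charmatrix_lt (i j : Fin n) :
    (A.charmatrix.adjugate i j).natDegree < n := by
  have hn : 0 < n := i.pos
  have hform : A.charmatrix.updateRow j (Pi.single i 1) =
      (Polynomial.X : ℝ[X]) • ((1 : Matrix (Fin n) (Fin n) ℝ).updateRow j 0).map Polynomial.C +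
        ((-A).updateRow j (Pi.single i 1)).map Polynomial.C := by
    refine Matrix.ext fun k l => ?_
    by_cases hk : k = j
    · subst hk
      by_cases hl : l = i
      · subst hl; simp
      · simp [hl]
    · by_cases hl : k = l
      · subst hl; simp [hk, sub_eq_add_neg]
      · simp [hk, hl]
  rw [Matrix.adjugate_apply, hform]
  refine lt_of_le_of_ne ?_ fun h => ?_
  · simpa using Polynomial.natDegree_det_X_add_C_le
      ((1 : Matrix (Fin n) (Fin n) ℝ).updateRow j 0) ((-A).updateRow j (Pi.single i 1))
  · have hc := Polynomial.coeff_det_X_add_C_card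
      ((1 : Matrix (Fin n) (Fin n) ℝ).updateRow j 0) ((-A).updateRow j (Pi.single i 1))
    have hdet : ((1 : Matrix (Fin n) (Fin n) ℝ).updateRow j 0).det = 0 :=
      Matrix.det_eq_zero_of_row_eq_zero j fun k => by rw [Matrix.updateRow_self]; rfl
    rw [hdet, Fintype.card_fin] at hc
    revert h hc
    generalize Matrix.det (n := Fin n) (R := ℝ[X]) _ = p
    intro h hc
    have h0 : p = 0 := Polynomial.leadingCoeff_eq_zero.mp (by rwa [Polynomial.leadingCoeff, h])
    rw [h0, Polynomial.natDegree_zero] at h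
    omega

/-- The matrix `s I - A` of rational functions. -/
def resolventInv : Matrix (Fin n) (Fin n) (RatFunc ℝ) :=
  Matrix.scalar (Fin n) (RatFunc.X : RatFunc ℝ) - A.map RatFunc.C

theorem resolventInv_eq_map : resolventInv A = A.charmatrix.map (algebraMap ℝ[X] (RatFunc ℝ)) := by
  refine Matrix.ext fun i j => ?_
  by_cases h : i = j
  · subst h
    simp [resolventInv]
  · simp [resolventInv, h]

theorem det_resolventInv : (resolventInv A).det = algebraMap ℝ[X] (RatFunc ℝ) A.charpoly := by
  rw [resolventInv_eq_map, Matrix.charpoly, RingHom.map_det]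
  rfl

theorem det_resolventInv_ne_zero : (resolventInv A).det ≠ 0 := by
  rw [det_resolventInv]
  exact RatFunc.algebraMap_ne_zero A.charpoly_monic.ne_zero

theorem resolventInv_inv_apply (i j : Fin n) : (resolventInv A)⁻¹ i j =
    algebraMap ℝ[X] (RatFunc ℝ) (A.charmatrix.adjugate i j) /
      algebraMap ℝ[X] (RatFunc ℝ) A.charpoly := by
  have hadj : (resolventInv A).adjugate i j =
      algebraMap ℝ[X] (RatFunc ℝ) (A.charmatrix.adjugate i j) := by
    have := RingHom.map_adjugate (algebraMap ℝ[X] (RatFunc ℝ)) A.charmatrix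
    rw [resolventInv_eq_map]
    exact (congrFun (congrFun this i) j).symm
  rw [Matrix.inv_def, Matrix.smul_apply, hadj, det_resolventInv, Ring.inverse_eq_inv', smul_eq_mul,
    div_eq_inv_mul]

/-- `sI - A` is not proper, but `I - A/s` is, and `s (sI - A)⁻¹` is its inverse. Properness of both
sides allows this inversion inside the operator calculus. -/
theorem proper_X_mul_resolvent (i j : Fin n) : Proper (RatFunc.X * (resolventInv A)⁻¹ i j) := by
  rw [resolventInv_inv_apply, ← mul_div_assoc, ← RatFunc.algebraMap_X, ← map_mul]
  refine proper_div A.charpoly_monic.ne_zero (Polynomial.natDegree_mul_le.trans ?_)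
  rw [A.charpoly_natDegree_eq_dim, Fintype.card_fin, Polynomial.natDegree_X]
  have := natDegree_adjugate_charmatrix_lt A i j
  omega

/-- The numerators `adj (s I - A) b` of `(s I - A)⁻¹ b`. -/
def stateNum (b : Fin n → ℝ) (i : Fin n) : ℝ[X] :=
  ∑ j, A.charmatrix.adjugate i j * Polynomial.C (b j)

variable (b : Fin n → ℝ)

theorem degree_stateNum_lt (i : Fin n) : (stateNum A b i).degree < n := by
  refine lt_of_le_of_lt (Polynomial.degree_sum_le _ _) ((Finset.sup_lt_iff ?_).mpr fun j _ => ?_)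
  · exact WithBot.bot_lt_coe n
  rw [mul_comm, ← Polynomial.smul_eq_C_mul]
  refine (Polynomial.degree_smul_le _ _).trans_lt ?_
  exact lt_of_le_of_lt Polynomial.degree_le_natDegree
    (by exact_mod_cast natDegree_adjugate_charmatrix_lt A i j)

/-- The vector of transfer functions `(s I - A)⁻¹ b`. -/
def stateTransfer (i : Fin n) : RatFunc ℝ := ∑ j, (resolventInv A)⁻¹ i j * RatFunc.C (b j)

theorem stateTransfer_eq_div (i : Fin n) : stateTransfer A b i =
    algebraMap ℝ[X] (RatFunc ℝ) (stateNum A b i) / algebraMap ℝ[X] (RatFunc ℝ) A.charpoly := by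
  unfold stateTransfer stateNum
  rw [map_sum, Finset.sum_div]
  refine Finset.sum_congr rfl fun j _ => ?_
  rw [resolventInv_inv_apply, map_mul, RatFunc.algebraMap_C]
  ring

theorem proper_stateTransfer (i : Fin n) : Proper (stateTransfer A b i) := by
  rw [stateTransfer_eq_div]
  refine proper_div A.charpoly_monic.ne_zero ?_
  rw [A.charpoly_natDegree_eq_dim, Fintype.card_fin]
  exact Polynomial.natDegree_le_of_degree_le (degree_stateNum_lt A b i).le

theorem stable_stateTransfer {A : Matrix (Fin n) (Fin n) ℝ} (hA : IsHurwitz A) (i : Fin n) :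
    Stable (stateTransfer A b i) := by
  rw [stateTransfer_eq_div]
  exact stable_div _ (stablePoly_charpoly hA)

/-- The integral equation reads `(I - A/s) y = (b/s) v` under `1/s ↦ J`. Applying the operators of
the proper inverse `s (sI - A)⁻¹` on the left solves it. -/
theorem eq_ioOp_stateTransfer {T : ℝ} (hT : 0 ≤ T) {y : Fin n → Sig T} {v : Sig T}
    (h : ∀ i, y i = volterra hT (∑ j, A i j • y j + b i • v)) (i : Fin n) :
    y i = ioOp hT (stateTransfer A b i) v := by
  set δ : Fin n → Fin n → RatFunc ℝ := fun j k => if j = k then 1 else 0 with hδ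
  set L : Fin n → Fin n → RatFunc ℝ :=
    fun j k => δ j k - RatFunc.X⁻¹ * RatFunc.C (A j k) with hL
  have hδp : ∀ j k, Proper (δ j k) := by
    intro j k
    simp only [hδ]
    split_ifs
    exacts [proper_one, proper_zero]
  have hLp : ∀ j k, Proper (L j k) := fun j k => (hδp j k).sub (proper_inv_X.mul (proper_C _))
  have hid : ∀ k, ∑ j, RatFunc.X * (resolventInv A)⁻¹ i j * L j k = δ i k := by
    intro k
    have h1 := congrFun (congrFun (Matrix.nonsing_inv_mul (resolventInv A)
      (det_resolventInv_ne_zero A).isUnit) i) k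
    rw [Matrix.mul_apply, Matrix.one_apply] at h1
    rw [show δ i k = _ from h1.symm]
    refine Finset.sum_congr rfl fun j _ => ?_
    have hX : (RatFunc.X : RatFunc ℝ) ≠ 0 := RatFunc.X_ne_zero
    by_cases hjk : j = k
    · subst hjk
      simp [hL, hδ, resolventInv]
      field_simp
    · simp [hL, hδ, resolventInv, hjk]
      field_simp
  have hLy : ∀ j, ∑ k, ioOp hT (L j k) (y k) = ioOp hT (RatFunc.C (b j) * RatFunc.X⁻¹) v := by
    intro j
    have h1 : ∀ k, ioOp hT (L j k) (y k) =
        (if j = k then y k else 0) - A j k • volterra hT (y k) := by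
      intro k
      rw [ioOp_sub hT (hδp j k) (proper_inv_X.mul (proper_C _)),
        ioOp_mul hT proper_inv_X (proper_C _), ioOp_inv_X, ioOp_C]
      simp only [hδ]
      split_ifs
      · simp [ioOp_one]
      · simp [ioOp_zero]
    rw [Finset.sum_congr rfl fun k _ => h1 k, Finset.sum_sub_distrib, Finset.sum_ite_eq,
      if_pos (Finset.mem_univ j), ioOp_mul hT (proper_C _) proper_inv_X, ioOp_inv_X, ioOp_C]
    conv_lhs => rw [h j]
    simp only [map_add, map_sum, map_smul]
    simp
  have hδy : y i = ∑ k, ioOp hT (δ i k) (y k) := by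
    have h1 : ∀ k, ioOp hT (δ i k) (y k) = if i = k then y k else 0 := by
      intro k
      simp only [hδ]
      split_ifs
      · simp [ioOp_one]
      · simp [ioOp_zero]
    rw [Finset.sum_congr rfl fun k _ => h1 k, Finset.sum_ite_eq, if_pos (Finset.mem_univ i)]
  have hp := proper_X_mul_resolvent A i
  rw [hδy]
  calc ∑ k, ioOp hT (δ i k) (y k)
      = ∑ k, ∑ j, ioOp hT (RatFunc.X * (resolventInv A)⁻¹ i j) (ioOp hT (L j k) (y k)) := by
        refine Finset.sum_congr rfl fun k _ => ?_
        rw [← hid k, ioOp_sum hT _ fun j _ => (hp j).mul (hLp j k)]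
        simp only [sum_apply]
        refine Finset.sum_congr rfl fun j _ => ?_
        rw [ioOp_mul hT (hp j) (hLp j k)]
        rfl
    _ = ∑ j, ioOp hT (RatFunc.X * (resolventInv A)⁻¹ i j)
          (ioOp hT (RatFunc.C (b j) * RatFunc.X⁻¹) v) := by
        rw [Finset.sum_comm]
        refine Finset.sum_congr rfl fun j _ => ?_
        rw [← map_sum, hLy j]
    _ = ioOp hT (stateTransfer A b i) v := by
        have h2 : stateTransfer A b i = ∑ j, (RatFunc.X * (resolventInv A)⁻¹ i j) *
            (RatFunc.C (b j) * RatFunc.X⁻¹) := by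
          refine Finset.sum_congr rfl fun j _ => ?_
          have hX : (RatFunc.X : RatFunc ℝ) ≠ 0 := RatFunc.X_ne_zero
          field_simp
        rw [h2, ioOp_sum hT _ fun j _ => (hp j).mul ((proper_C _).mul proper_inv_X)]
        simp only [sum_apply]
        refine Finset.sum_congr rfl fun j _ => ?_
        rw [ioOp_mul hT (hp j) ((proper_C _).mul proper_inv_X)]
        rfl

theorem eq_ioOp_of_hasDerivWithinAt {T : ℝ} (hT : 0 ≤ T) {y : ℝ → Fin n → ℝ} {v : ℝ → ℝ}
    (h0 : y 0 = 0)
    (hy : ∀ t, 0 ≤ t → HasDerivWithinAt y (A *ᵥ y t + v t • b) (Set.Ici 0) t)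
    (hyc : ∀ i, ContinuousOn (fun t => y t i) (Set.Icc 0 T)) (hv : ContinuousOn v (Set.Icc 0 T))
    (i : Fin n) : Sig.mk (fun t => y t i) (hyc i) = ioOp hT (stateTransfer A b i) (Sig.mk v hv) := by
  refine eq_ioOp_stateTransfer A b hT (y := fun i => Sig.mk (fun t => y t i) (hyc i))
    (fun i => ?_) i
  ext t
  rw [volterra_apply, Sig.mk_apply]
  have hsub : Set.uIcc 0 (t : ℝ) ⊆ Set.Icc 0 T := by
    rw [Set.uIcc_of_le t.2.1]
    exact Set.Icc_subset_Icc_right t.2.2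
  have hint : ∫ s in (0 : ℝ)..t, (A *ᵥ y s + v s • b) i = y t i - y 0 i := by
    refine intervalIntegral.integral_eq_sub_of_hasDeriv_right (f := fun s => y s i)
      ((hyc i).mono hsub) (fun s hs => ?_) ?_
    · rw [min_eq_left t.2.1] at hs
      exact (hasDerivWithinAt_pi.mp (hy s hs.1.le) i).mono
        (fun r hr => hs.1.le.trans (le_of_lt hr))
    · refine ContinuousOn.intervalIntegrable ?_
      simp only [Pi.add_apply, Pi.smul_apply, smul_eq_mul, Matrix.mulVec, dotProduct]
      refine ContinuousOn.add (continuousOn_finsetSum _ fun j _ => ?_) ?_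
      · exact continuousOn_const.mul ((hyc j).mono hsub)
      · exact (hv.mono hsub).mul continuousOn_const
  rw [h0, Pi.zero_apply, sub_zero] at hint
  rw [← hint]
  refine intervalIntegral.integral_congr fun s hs => ?_
  rw [Set.projIcc_of_mem hT (hsub hs)]
  simp [Matrix.mulVec, dotProduct, mul_comm]

end StateSpace

/-! ### Minimum phase outputs -/

section MinPhase

variable {n : ℕ} {A : Matrix (Fin n) (Fin n) ℝ} {b K : Fin n → ℝ}

theorem Ho_eq_stateTransfer (A : Matrix (Fin n) (Fin n) ℝ) (b K : Fin n → ℝ) (i : Fin n) :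
    Ho A b K i = stateTransfer (Am A b K) b i := rfl

theorem vecHo_eq_div (v : Fin n → ℝ) : vecHo A b K v =
    algebraMap ℝ[X] (RatFunc ℝ) (∑ i, Polynomial.C (v i) * stateNum (Am A b K) b i) /
      algebraMap ℝ[X] (RatFunc ℝ) (Am A b K).charpoly := by
  unfold vecHo
  rw [map_sum, Finset.sum_div]
  refine Finset.sum_congr rfl fun i _ => ?_
  rw [Ho_eq_stateTransfer, stateTransfer_eq_div, map_mul, RatFunc.algebraMap_C, mul_div_assoc]

theorem degree_sum_C_mul_stateNum_lt (A : Matrix (Fin n) (Fin n) ℝ) (b v : Fin n → ℝ) :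
    (∑ i, Polynomial.C (v i) * stateNum A b i).degree < n := by
  refine lt_of_le_of_lt (Polynomial.degree_sum_le _ _) ((Finset.sup_lt_iff ?_).mpr fun i _ => ?_)
  · exact WithBot.bot_lt_coe n
  rw [← Polynomial.smul_eq_C_mul]
  exact (Polynomial.degree_smul_le _ _).trans_lt <| degree_stateNum_lt A b i

/-- This is `(sI - A) adj(sI - A) b = det(sI - A) b`, read row by row. It converts multiplication by
`s` into the action of `A` on output vectors. -/
theorem X_mul_stateNum (A : Matrix (Fin n) (Fin n) ℝ) (b : Fin n → ℝ) (i : Fin n) :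
    Polynomial.X * stateNum A b i =
      ∑ k, Polynomial.C (A i k) * stateNum A b k + A.charpoly * Polynomial.C (b i) := by
  have h1 : A.charmatrix *ᵥ stateNum A b = A.charpoly • fun j => Polynomial.C (b j) := by
    have : stateNum A b = A.charmatrix.adjugate *ᵥ fun j => Polynomial.C (b j) := rfl
    rw [this, Matrix.mulVec_mulVec, Matrix.mul_adjugate, Matrix.smul_mulVec, Matrix.one_mulVec]
    rfl
  have h2 := congrFun h1 i
  rw [Matrix.charmatrix, Matrix.sub_mulVec] at h2
  simp only [Pi.sub_apply, Pi.smul_apply, smul_eq_mul] at h2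
  rw [← h2]
  simp [Matrix.mulVec, dotProduct, Matrix.diagonal_apply]

/-- If the output `v` sees nothing, then it annihilates `b` and `vᵀ A` sees nothing. -/
theorem dotProduct_eq_zero_of_sum_stateNum_eq_zero {v : Fin n → ℝ}
    (h : ∑ i, Polynomial.C (v i) * stateNum A b i = 0) :
    v ⬝ᵥ b = 0 ∧ ∑ i, Polynomial.C ((v ᵥ* A) i) * stateNum A b i = 0 := by
  have e : (∑ k, Polynomial.C ((v ᵥ* A) k) * stateNum A b k) +
      A.charpoly * Polynomial.C (v ⬝ᵥ b) = 0 := by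
    calc _ = ∑ i, Polynomial.C (v i) * (Polynomial.X * stateNum A b i) := by
          simp only [X_mul_stateNum, mul_add, Finset.sum_add_distrib]
          congr 1
          · simp only [Matrix.vecMul, dotProduct, map_sum, map_mul, Finset.sum_mul, Finset.mul_sum]
            rw [Finset.sum_comm]
            exact Finset.sum_congr rfl fun _ _ => Finset.sum_congr rfl fun _ _ => by ring
          · simp only [dotProduct, map_sum, map_mul, Finset.mul_sum]
            exact Finset.sum_congr rfl fun _ _ => by ring
      _ = Polynomial.X * ∑ i, Polynomial.C (v i) * stateNum A b i := by
          rw [Finset.mul_sum]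
          exact Finset.sum_congr rfl fun _ _ => by ring
      _ = 0 := by rw [h, mul_zero]
  have hvb : v ⬝ᵥ b = 0 := by
    -- In degree `n` only the monic characteristic polynomial contributes.
    have h1 := congrArg (fun p : ℝ[X] => p.coeff n) e
    simp only [Polynomial.coeff_add, Polynomial.coeff_mul_C, Polynomial.coeff_zero] at h1
    rw [Polynomial.coeff_eq_zero_of_degree_lt (degree_sum_C_mul_stateNum_lt A b (v ᵥ* A))] at h1
    have hc : A.charpoly.coeff n = 1 := by
      have := A.charpoly_monic.coeff_natDegree
      rwa [A.charpoly_natDegree_eq_dim, Fintype.card_fin] at this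
    rw [hc] at h1
    linarith
  exact ⟨hvb, by simpa [hvb] using e⟩

/-- Iterating the previous lemma gives `vᵀA_mᵏ b = 0` for all `k`. Since `A = A_m + b Kᵀ`, the
feedback is then invisible to `v`: `vᵀAᵏ = vᵀA_mᵏ`. So `v` annihilates every `Aᵏ b`, and these span.
-/
theorem eq_zero_of_sum_stateNum_eq_zero (hctrl : IsControllable A b) {v : Fin n → ℝ}
    (h : ∑ i, Polynomial.C (v i) * stateNum (Am A b K) b i = 0) : v = 0 := by
  have hk : ∀ k : ℕ, ∑ i, Polynomial.C ((v ᵥ* (Am A b K) ^ k) i) * stateNum (Am A b K) b i = 0 := by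
    intro k
    induction k with
    | zero => simpa using h
    | succ k ih =>
      have := (dotProduct_eq_zero_of_sum_stateNum_eq_zero ih).2
      rwa [Matrix.vecMul_vecMul, ← pow_succ] at this
  have hpow : ∀ k : ℕ, v ᵥ* A ^ k = v ᵥ* (Am A b K) ^ k := by
    intro k
    induction k with
    | zero => rfl
    | succ k ih =>
      have hA : A = Am A b K + Matrix.vecMulVec b K := by simp [Am]
      have h0 := (dotProduct_eq_zero_of_sum_stateNum_eq_zero (hk k)).1
      rw [pow_succ, ← Matrix.vecMul_vecMul, ih]
      calc _ = v ᵥ* Am A b K ^ k ᵥ* (Am A b K + Matrix.vecMulVec b K) := by rw [← hA]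
        _ = _ := by
          rw [Matrix.vecMul_add, Matrix.vecMul_vecMul, ← pow_succ, Matrix.vecMul_vecMulVec, h0,
            zero_smul, add_zero]
  have hker : ∀ w : Fin n → ℝ, v ⬝ᵥ w = 0 := by
    intro w
    have hw : w ∈ Submodule.span ℝ (Set.range fun k : Fin n => (A ^ (k : ℕ)) *ᵥ b) := by
      rw [hctrl]; trivial
    induction hw using Submodule.span_induction with
    | mem w hw =>
      obtain ⟨k, rfl⟩ := hw
      simp only
      rw [Matrix.dotProduct_mulVec, hpow]
      exact (dotProduct_eq_zero_of_sum_stateNum_eq_zero (hk k)).1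
    | zero => simp
    | add x y _ _ hx hy => rw [dotProduct_add, hx, hy, add_zero]
    | smul a x _ hx => rw [dotProduct_smul, hx, smul_zero]
  exact dotProduct_self_eq_zero.mp (hker v)

/-- The map from `v` to the coefficients of its numerator is an injective endomorphism of `ℝⁿ`,
hence surjective. Any stable numerator of degree `n - 1` would do; `(s + 1)ⁿ⁻¹` is taken. -/
theorem exists_isMinPhaseOutput (hn : 0 < n) (hctrl : IsControllable A b)
    (hK : IsHurwitz (Am A b K)) : ∃ co : Fin n → ℝ, IsMinPhaseOutput A b K co := by
  let L : (Fin n → ℝ) →ₗ[ℝ] (Fin n → ℝ) :=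
    { toFun := fun v k => (∑ i, Polynomial.C (v i) * stateNum (Am A b K) b i).coeff k
      map_add' := fun v w => by
        ext k
        simp [add_mul, Finset.sum_add_distrib]
      map_smul' := fun c v => by
        ext k
        simp [Finset.mul_sum, mul_assoc] }
  have hL : ∀ v k, L v k = (∑ i, Polynomial.C (v i) * stateNum (Am A b K) b i).coeff k :=
    fun _ _ => rfl
  have hext : ∀ (v : Fin n → ℝ) (p : ℝ[X]), p.degree < n → (∀ k, L v k = p.coeff k) →
      ∑ i, Polynomial.C (v i) * stateNum (Am A b K) b i = p := by
    intro v p hp h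
    ext k
    by_cases hk : k < n
    · exact h ⟨k, hk⟩
    · have hk' : (n : WithBot ℕ) ≤ k := by exact_mod_cast not_lt.mp hk
      rw [Polynomial.coeff_eq_zero_of_degree_lt
          ((degree_sum_C_mul_stateNum_lt (Am A b K) b v).trans_le hk'),
        Polynomial.coeff_eq_zero_of_degree_lt (hp.trans_le hk')]
  have hinj : Function.Injective L := by
    refine (injective_iff_map_eq_zero L).mpr fun v hv => ?_
    refine eq_zero_of_sum_stateNum_eq_zero (K := K) hctrl (hext v 0 (by simp) fun k => ?_)
    simp [hv]
  obtain ⟨co, hco⟩ := LinearMap.injective_iff_surjective.mp hinj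
    fun k => ((Polynomial.X + Polynomial.C 1 : ℝ[X]) ^ (n - 1)).coeff k
  have hdeg : ((Polynomial.X + Polynomial.C 1 : ℝ[X]) ^ (n - 1)).natDegree = n - 1 := by
    rw [Polynomial.natDegree_pow, Polynomial.natDegree_X_add_C, mul_one]
  have hne : ((Polynomial.X + Polynomial.C 1 : ℝ[X]) ^ (n - 1)) ≠ 0 :=
    pow_ne_zero _ (Polynomial.X_add_C_ne_zero 1)
  refine ⟨co, (Polynomial.X + Polynomial.C 1 : ℝ[X]) ^ (n - 1), (Am A b K).charpoly,
    ⟨hne, fun z hz => ?_⟩, stablePoly_charpoly hK, ?_, ?_⟩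
  · simp only [map_one, map_pow, map_add, Polynomial.aeval_X] at hz
    have : z = -1 := eq_neg_of_add_eq_zero_left (eq_zero_of_pow_eq_zero hz)
    simp [this]
  · rw [hdeg, Matrix.charpoly_natDegree_eq_dim, Fintype.card_fin]
    omega
  · rw [vecHo_eq_div, hext co _ ?_ fun k => congrFun hco k]
    rw [Polynomial.degree_eq_natDegree hne, hdeg]
    exact_mod_cast Nat.sub_lt hn one_pos

variable {C : RatFunc ℝ} {v : Fin n → ℝ}

theorem IsMinPhaseOutput.vecHo_ne_zero (h : IsMinPhaseOutput A b K v) : vecHo A b K v ≠ 0 := by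
  obtain ⟨Nn, Nd, hNn, hNd, -, he⟩ := h
  rw [he]
  exact div_ne_zero (RatFunc.algebraMap_ne_zero hNn.1) (RatFunc.algebraMap_ne_zero hNd.1)

/-- The inverse of `vᵀH_o` has relative degree minus one, which the strict properness of `C`
compensates. -/
theorem proper_filteredInverse (hC : StrictlyProper C) (h : IsMinPhaseOutput A b K v)
    (i : Fin 1) (j : Fin n) : Proper (filteredInverse A b K C v i j) := by
  unfold filteredInverse
  refine Proper.mul ?_ (proper_C _)
  by_cases h0 : C = 0
  · rw [h0, zero_mul]; exact proper_zero
  have hne := h.vecHo_ne_zero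
  obtain ⟨Nn, Nd, hNn, hNd, hdeg, he⟩ := h
  have := hC.intDegree_neg h0
  unfold Proper
  rw [RatFunc.intDegree_mul h0 (one_div_ne_zero hne), one_div, RatFunc.intDegree_inv, he,
    intDegree_div_polynomial hNn.1 hNd.1]
  omega

theorem stable_filteredInverse (hC : Stable C) (h : IsMinPhaseOutput A b K v)
    (i : Fin 1) (j : Fin n) : Stable (filteredInverse A b K C v i j) := by
  unfold filteredInverse
  obtain ⟨Nn, Nd, hNn, hNd, hdeg, he⟩ := h
  refine (hC.mul ?_).mul (stable_C _)
  rw [he, one_div_div]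
  exact stable_div Nd hNn

theorem sum_filteredInverse_mul_Ho (h : IsMinPhaseOutput A b K v) (i : Fin 1) :
    ∑ j, filteredInverse A b K C v i j * Ho A b K j = C := by
  have hne := h.vecHo_ne_zero
  calc _ = C * (1 / vecHo A b K v) * vecHo A b K v := by
        rw [vecHo, Finset.mul_sum]
        exact Finset.sum_congr rfl fun j _ => by rw [filteredInverse, vecHo]; ring
    _ = C := by field_simp

end MinPhase

/-! ### Absolutely continuous functions -/

theorem absolutelyContinuousOnInterval_of_dist_le {X Y : Type*} [PseudoMetricSpace X]
    [PseudoMetricSpace Y] {f : ℝ → X} {g : ℝ → Y} {a b : ℝ}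
    (hf : AbsolutelyContinuousOnInterval f a b)
    (h : ∀ s ∈ Set.uIcc a b, ∀ t ∈ Set.uIcc a b, dist (g s) (g t) ≤ dist (f s) (f t)) :
    AbsolutelyContinuousOnInterval g a b := by
  rw [absolutelyContinuousOnInterval_iff] at hf ⊢
  intro ε hε
  obtain ⟨δ, hδ, hfδ⟩ := hf ε hε
  refine ⟨δ, hδ, fun E hE hlt => lt_of_le_of_lt ?_ (hfδ E hE hlt)⟩
  exact Finset.sum_le_sum fun i hi => h _ (hE.1 i hi).1 _ (hE.1 i hi).2

/-- A barrier: an absolutely continuous function whose derivative is nonpositive wherever the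
function is above `B` stays below `B`. -/
theorem le_of_hasDerivAt_nonpos_above {f : ℝ → ℝ} {T B : ℝ} (hT : 0 ≤ T)
    (hf : AbsolutelyContinuousOnInterval f 0 T) (h0 : f 0 ≤ B)
    (hd : ∀ᵐ t, t ∈ Set.Ioo 0 T → ∀ f', HasDerivAt f f' t → B < f t → f' ≤ 0) : f T ≤ B := by
  -- The truncation `max f B` starts at `B` and has nonpositive derivative almost everywhere, so it
  -- ends at most at `B`.
  have hF : AbsolutelyContinuousOnInterval (fun t => max (f t) B) 0 T :=
    absolutelyContinuousOnInterval_of_dist_le hf fun s _ t _ =>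
      abs_max_sub_max_le_abs (f s) (f t) B
  have hint := hF.integral_deriv_eq_sub
  have hle : ∫ t in (0 : ℝ)..T, deriv (fun t => max (f t) B) t ≤ 0 := by
    rw [intervalIntegral.integral_of_le hT, MeasureTheory.integral_Ioc_eq_integral_Ioo]
    refine MeasureTheory.integral_nonpos_of_ae ?_
    refine (MeasureTheory.ae_restrict_iff' measurableSet_Ioo).mpr ?_
    filter_upwards [hd] with t ht hmem
    rw [Pi.zero_apply]
    rcases le_or_gt (f t) B with hB | hB
    -- Where `f t ≤ B` the truncation takes its global minimum, so its `deriv` is zero.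
    · have hmin : IsLocalMin (fun t => max (f t) B) t := by
        refine Filter.Eventually.of_forall fun s => ?_
        simp only [max_eq_right hB]
        exact le_max_right _ _
      exact hmin.deriv_eq_zero.le
    · have hc : ContinuousAt f t := by
        refine hf.continuousOn.continuousAt ?_
        rw [Set.uIcc_of_le hT]
        exact Icc_mem_nhds hmem.1 hmem.2
      have heq : (fun t => max (f t) B) =ᶠ[nhds t] f := by
        filter_upwards [hc.eventually (lt_mem_nhds hB)] with s hs using max_eq_left (le_of_lt hs)
      rw [heq.deriv_eq]
      by_cases hdiff : DifferentiableAt ℝ f t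
      · exact ht hmem _ hdiff.hasDerivAt hB
      · exact (deriv_zero_of_not_differentiableAt hdiff).le
  rw [hint, max_eq_right h0] at hle
  exact (le_max_left _ _).trans (sub_nonpos.mp hle)

theorem absolutelyContinuousOnInterval_integral_add {E : Type*} [NormedAddCommGroup E]
    [NormedSpace ℝ E] {f g : ℝ → E} {e : E} {T : ℝ} (hT : 0 ≤ T)
    (hf : ∀ t, 0 ≤ t → IntervalIntegrable f MeasureTheory.volume 0 t)
    (hg : ∀ t, 0 ≤ t → g t = e + ∫ s in (0 : ℝ)..t, f s) :
    AbsolutelyContinuousOnInterval g 0 T := by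
  have hN := (hf T hT).norm.absolutelyContinuousOnInterval_intervalIntegral
    (c := 0) Set.left_mem_uIcc
  refine absolutelyContinuousOnInterval_of_dist_le hN fun s hs t ht => ?_
  rw [Set.uIcc_of_le hT] at hs ht
  rw [hg s hs.1, hg t ht.1, dist_add_left, dist_eq_norm, Real.dist_eq,
    intervalIntegral.integral_interval_sub_left (hf s hs.1) (hf t ht.1),
    intervalIntegral.integral_interval_sub_left (hf s hs.1).norm (hf t ht.1).norm]
  exact intervalIntegral.norm_integral_le_abs_integral_norm

theorem absolutelyContinuousOnInterval_of_hasDerivWithinAt {f f' : ℝ → ℝ} {T : ℝ} (hT : 0 ≤ T)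
    (hf : ∀ t, 0 ≤ t → HasDerivWithinAt f (f' t) (Set.Ici 0) t)
    (hf' : ContinuousOn f' (Set.Ici 0)) : AbsolutelyContinuousOnInterval f 0 T := by
  have hint : ∀ t, 0 ≤ t → IntervalIntegrable f' MeasureTheory.volume 0 t := fun t ht => by
    refine (hf'.mono ?_).intervalIntegrable
    rw [Set.uIcc_of_le ht]
    exact Set.Icc_subset_Ici_self
  refine absolutelyContinuousOnInterval_integral_add hT hint (e := f 0) fun t ht => ?_
  rw [intervalIntegral.integral_eq_sub_of_hasDeriv_right (f := f) ?_ (fun s hs => ?_) (hint t ht)]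
  · ring
  · rw [Set.uIcc_of_le ht]
    exact fun s hs => ((hf s hs.1).mono Set.Icc_subset_Ici_self).continuousWithinAt
  · rw [min_eq_left ht] at hs
    exact (hf s hs.1.le).mono fun r hr => hs.1.le.trans (le_of_lt hr)

/-! ### The projection operator -/

section Projection

variable {n : ℕ} {Θ S : Set (EuclideanSpace ℝ (Fin n))} {p y z v w : EuclideanSpace ℝ (Fin n)}

theorem inner_sub_nonpos_of_forall_norm_le (hS : Convex ℝ S) (hz : z ∈ S)
    (h : ∀ w ∈ S, ‖y - z‖ ≤ ‖y - w‖) (hw : w ∈ S) : inner ℝ (y - z) (w - z) ≤ 0 := by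
  refine (norm_eq_iInf_iff_real_inner_le_zero hS hz).mp (le_antisymm ?_ ?_) w hw
  · have : Nonempty S := ⟨⟨z, hz⟩⟩
    exact le_ciInf fun w => h w w.2
  · exact ciInf_le ⟨0, by rintro _ ⟨w, rfl⟩; exact norm_nonneg _⟩ (⟨z, hz⟩ : S)

theorem exists_mem_forall_norm_le (hS : IsClosed S) (hne : S.Nonempty)
    (y : EuclideanSpace ℝ (Fin n)) : ∃ z ∈ S, ∀ w ∈ S, ‖y - z‖ ≤ ‖y - w‖ := by
  obtain ⟨z, hz, h⟩ := hS.exists_infDist_eq_dist hne y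
  refine ⟨z, hz, fun w hw => ?_⟩
  rw [← dist_eq_norm, ← dist_eq_norm, ← h]
  exact Metric.infDist_le_dist_of_mem hw

theorem nearest_spec (hS : IsClosed S) (hne : S.Nonempty) (y : EuclideanSpace ℝ (Fin n)) :
    nearest S y ∈ S ∧ ∀ w ∈ S, ‖y - nearest S y‖ ≤ ‖y - w‖ :=
  Classical.epsilon_spec (p := fun z => z ∈ S ∧ ∀ w ∈ S, ‖y - z‖ ≤ ‖y - w‖)
    (exists_mem_forall_norm_le hS hne y)

theorem smul_mem_tangentCone (hv : v ∈ tangentCone Θ p) {a : ℝ} (ha : 0 ≤ a) :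
    a • v ∈ tangentCone Θ p := by
  refine map_mem_closure (continuous_const_smul a) hv ?_
  rintro _ ⟨c, hc, z, hz, rfl⟩
  exact ⟨a * c, mul_nonneg ha hc, z, hz, smul_smul a c _⟩

theorem add_mem_tangentCone (hΘ : Convex ℝ Θ) (hv : v ∈ tangentCone Θ p)
    (hw : w ∈ tangentCone Θ p) : v + w ∈ tangentCone Θ p := by
  refine map_mem_closure₂ continuous_add hv hw ?_
  rintro _ ⟨a, ha, z, hz, rfl⟩ _ ⟨c, hc, z', hz', rfl⟩
  rcases (add_nonneg ha hc).eq_or_lt with h0 | h0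
  · have ha0 : a = 0 := by linarith
    have hc0 : c = 0 := by linarith
    exact ⟨0, le_rfl, z, hz, by simp [ha0, hc0]⟩
  · refine ⟨a + c, h0.le, (a / (a + c)) • z + (c / (a + c)) • z', ?_, ?_⟩
    · exact hΘ hz hz' (by positivity) (by positivity) (by field_simp)
    · rw [smul_sub (a + c), smul_add, smul_smul, smul_smul, mul_div_cancel₀ _ h0.ne',
        mul_div_cancel₀ _ h0.ne']
      module

theorem convex_tangentCone (hΘ : Convex ℝ Θ) (p : EuclideanSpace ℝ (Fin n)) :
    Convex ℝ (tangentCone Θ p) := fun _ hv _ hw _ _ ha hc _ =>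
  add_mem_tangentCone hΘ (smul_mem_tangentCone hv ha) (smul_mem_tangentCone hw hc)

theorem sub_mem_tangentCone (hz : z ∈ Θ) : z - p ∈ tangentCone Θ p :=
  subset_closure ⟨1, zero_le_one, z, hz, (one_smul ℝ _).symm⟩

theorem proj_mem_tangentCone (hne : Θ.Nonempty) (p y : EuclideanSpace ℝ (Fin n)) :
    proj Θ p y ∈ tangentCone Θ p :=
  (nearest_spec isClosed_closure ⟨_, sub_mem_tangentCone hne.some_mem⟩ y).1

/-- The tangent cone is closed under addition, so `proj + (z - p)` is an admissible competitor in
the variational inequality. In the Lyapunov estimate this says that projecting can only decrease the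
derivative. -/
theorem inner_sub_proj_nonpos (hΘ : Convex ℝ Θ) (hz : z ∈ Θ) (p y : EuclideanSpace ℝ (Fin n)) :
    inner ℝ (y - proj Θ p y) (z - p) ≤ 0 := by
  have hspec := nearest_spec (S := tangentCone Θ p) isClosed_closure ⟨_, sub_mem_tangentCone hz⟩ y
  have h := inner_sub_nonpos_of_forall_norm_le (convex_tangentCone hΘ p) hspec.1 hspec.2
    (add_mem_tangentCone hΘ hspec.1 (sub_mem_tangentCone hz))
  rwa [add_sub_cancel_left] at h

/-- The tangent directions at a point outside `Θ` do not lead away from the nearest point. -/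
theorem inner_sub_nearest_nonpos (hΘ : Convex ℝ Θ) (hz : z ∈ Θ)
    (h : ∀ w ∈ Θ, ‖p - z‖ ≤ ‖p - w‖) (hv : v ∈ tangentCone Θ p) : inner ℝ (p - z) v ≤ 0 := by
  have hcl : IsClosed {v : EuclideanSpace ℝ (Fin n) | inner ℝ (p - z) v ≤ 0} :=
    isClosed_le (continuous_const.inner continuous_id) continuous_const
  refine closure_minimal ?_ hcl hv
  rintro _ ⟨a, ha, w, hw, rfl⟩
  rw [Set.mem_ofPred_eq, real_inner_smul_right]
  refine mul_nonpos_of_nonneg_of_nonpos ha ?_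
  have h1 := inner_sub_nonpos_of_forall_norm_le hΘ hz h hw
  have h2 : w - p = (w - z) - (p - z) := by abel
  rw [h2, inner_sub_right, real_inner_self_eq_norm_sq]
  nlinarith [sq_nonneg ‖p - z‖]

/-- A trajectory with velocity in the tangent cones of `Θ` that starts in `Θ` stays in `Θ`. -/
theorem mem_of_integral_tangentCone (hΘc : IsClosed Θ) (hΘ : Convex ℝ Θ)
    {f g : ℝ → EuclideanSpace ℝ (Fin n)} (hp : p ∈ Θ)
    (hf : ∀ t, 0 ≤ t → IntervalIntegrable f MeasureTheory.volume 0 t)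
    (hg : ∀ t, 0 ≤ t → g t = p + ∫ s in (0 : ℝ)..t, f s)
    (hfg : ∀ t, f t ∈ tangentCone Θ (g t)) {T : ℝ} (hT : 0 ≤ T) : g T ∈ Θ := by
  have hne : Θ.Nonempty := ⟨p, hp⟩
  have hAC : AbsolutelyContinuousOnInterval (fun t => Metric.infDist (g t) Θ) 0 T :=
    absolutelyContinuousOnInterval_of_dist_le
      (absolutelyContinuousOnInterval_integral_add hT hf hg) fun s _ t _ => by
        simpa using (Metric.lipschitz_infDist_pt Θ).dist_le_mul (g s) (g t)
  have h0 : Metric.infDist (g 0) Θ ≤ 0 := by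
    rw [hg 0 le_rfl, intervalIntegral.integral_same, add_zero, Metric.infDist_zero_of_mem hp]
  have key := le_of_hasDerivAt_nonpos_above hT hAC h0 <| by
    filter_upwards [(hf T hT).ae_hasDerivAt_integral] with t ht hmem f' hf' hpos
    have hgd : HasDerivAt g (f t) t := by
      have h1 := (ht (by rw [Set.uIcc_of_le hT]; exact Set.Ioo_subset_Icc_self hmem) 0
        Set.left_mem_uIcc).const_add p
      refine h1.congr_of_eventuallyEq ?_
      filter_upwards [lt_mem_nhds hmem.1] with s hs using hg s (le_of_lt hs)
    obtain ⟨z, hz, hmin⟩ := exists_mem_forall_norm_le hΘc hne (g t)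
    have hdist : Metric.infDist (g t) Θ = ‖g t - z‖ := by
      refine le_antisymm ?_ ((Metric.le_infDist hne).mpr fun w hw => ?_)
      · rw [← dist_eq_norm]; exact Metric.infDist_le_dist_of_mem hz
      · rw [dist_eq_norm]; exact hmin w hw
    -- The squared distance to `Θ` is compared with the squared distance to the frozen nearest point
    -- `z`: the former is never larger and agrees at `t`, so the derivatives agree there.
    have hmax : IsLocalMax (fun s => Metric.infDist (g s) Θ ^ 2 - ‖g s - z‖ ^ 2) t := by
      refine Filter.Eventually.of_forall fun s => ?_
      simp only [hdist, sub_self]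
      rw [sub_nonpos, ← dist_eq_norm]
      exact pow_le_pow_left₀ Metric.infDist_nonneg (Metric.infDist_le_dist_of_mem hz) 2
    have hd := hmax.hasDerivAt_eq_zero ((hf'.pow 2).sub (hgd.sub_const z).norm_sq)
    have hin := inner_sub_nearest_nonpos hΘ hz hmin (hfg t)
    have : Metric.infDist (g t) Θ * f' ≤ 0 := by
      norm_num at hd
      linarith
    nlinarith
  have hzero : Metric.infDist (g T) Θ = 0 := le_antisymm key Metric.infDist_nonneg
  exact (hΘc.mem_iff_infDist_zero hne).mpr hzero

end Projection

/-! ### The prediction error of the adaptive loop -/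

section Adaptive

theorem adaptRate_mem_tangentCone {n : ℕ} {Θ : Set (EuclideanSpace ℝ (Fin n))}
    (hne : Θ.Nonempty) (P : Matrix (Fin n) (Fin n) ℝ) (b : Fin n → ℝ) {Γc : ℝ} (hΓc : 0 ≤ Γc)
    (p : EuclideanSpace ℝ (Fin n)) (x xhat : Fin n → ℝ) :
    adaptRate Θ P b Γc p x xhat ∈ tangentCone Θ p :=
  smul_mem_tangentCone (proj_mem_tangentCone hne _ _) hΓc

theorem Am_mulVec {n : ℕ} (A : Matrix (Fin n) (Fin n) ℝ) (b K v : Fin n → ℝ) :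
    Am A b K *ᵥ v = A *ᵥ v - (K ⬝ᵥ v) • b := by
  rw [Am, Matrix.sub_mulVec, Matrix.vecMulVec_mulVec, op_smul_eq_smul]

theorem inner_eq_dotProduct {n : ℕ} (p q : EuclideanSpace ℝ (Fin n)) :
    inner ℝ p q = p.ofLp ⬝ᵥ q.ofLp := by
  rw [PiLp.inner_apply]
  simp [dotProduct, mul_comm]

variable {n : ℕ} {A : Matrix (Fin n) (Fin n) ℝ} {b c K : Fin n → ℝ} {C : RatFunc ℝ}
  {P Q : Matrix (Fin n) (Fin n) ℝ} {Γc : ℝ} {Θ : Set (EuclideanSpace ℝ (Fin n))}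
  {r : ℝ → ℝ} {x₀ : Fin n → ℝ} {θhat₀ : EuclideanSpace ℝ (Fin n)}
  {θ : ℝ → EuclideanSpace ℝ (Fin n)} {dθ : ℝ} {x : ℝ → Fin n → ℝ} {u : ℝ → ℝ}
  {xhat : ℝ → Fin n → ℝ} {θhat : ℝ → EuclideanSpace ℝ (Fin n)}

theorem IsPlant.continuousOn (h : IsPlant A b x₀ θ x u) : ContinuousOn x (Set.Ici 0) :=
  fun t ht => (h.ode t ht).continuousWithinAt

theorem IsAdaptiveLoop.continuousOn_xhat
    (h : IsAdaptiveLoop A b c K C Θ P Γc r x₀ θhat₀ θ x u xhat θhat) :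
    ContinuousOn xhat (Set.Ici 0) :=
  fun t ht => (h.predictor t ht).continuousWithinAt

theorem IsAdaptiveLoop.absolutelyContinuous_θhat
    (h : IsAdaptiveLoop A b c K C Θ P Γc r x₀ θhat₀ θ x u xhat θhat) {T : ℝ} (hT : 0 ≤ T) :
    AbsolutelyContinuousOnInterval θhat 0 T :=
  absolutelyContinuousOnInterval_integral_add hT h.adapt_integrable h.adapt

theorem IsAdaptiveLoop.continuousOn_θhat
    (h : IsAdaptiveLoop A b c K C Θ P Γc r x₀ θhat₀ θ x u xhat θhat) :
    ContinuousOn θhat (Set.Ici 0) := by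
  intro t ht
  have ht' : (0 : ℝ) ≤ t := ht
  have hc := (h.absolutelyContinuous_θhat (T := t + 1) (by linarith)).continuousOn
  rw [Set.uIcc_of_le (by linarith)] at hc
  refine (hc t ⟨ht', by linarith⟩).mono_of_mem_nhdsWithin ?_
  filter_upwards [self_mem_nhdsWithin, mem_nhdsWithin_of_mem_nhds (gt_mem_nhds (lt_add_one t))]
    with s hs hs' using ⟨hs, le_of_lt hs'⟩

theorem IsAdaptiveLoop.θhat_mem
    (h : IsAdaptiveLoop A b c K C Θ P Γc r x₀ θhat₀ θ x u xhat θhat) (hΓc : 0 ≤ Γc)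
    (hΘc : IsClosed Θ) (hΘ : Convex ℝ Θ) (h0 : θhat₀ ∈ Θ) {t : ℝ} (ht : 0 ≤ t) : θhat t ∈ Θ :=
  mem_of_integral_tangentCone hΘc hΘ h0 h.adapt_integrable h.adapt
    (fun _ => adaptRate_mem_tangentCone ⟨_, h0⟩ P b hΓc _ _ _) ht

/-- The prediction error `x̂ - x` obeys `e' = A_m e - b (θ̂ - θ)ᵀ x`. -/
theorem IsAdaptiveLoop.hasDerivWithinAt_sub
    (h : IsAdaptiveLoop A b c K C Θ P Γc r x₀ θhat₀ θ x u xhat θhat) {t : ℝ} (ht : 0 ≤ t) :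
    HasDerivWithinAt (fun t => xhat t - x t) (Am A b K *ᵥ (xhat t - x t) +
      (-((θhat t - θ t).ofLp ⬝ᵥ x t)) • b) (Set.Ici 0) t := by
  refine ((h.predictor t ht).sub (h.plant.ode t ht)).congr_deriv ?_
  rw [Matrix.mulVec_sub, Am_mulVec A b K (x t), WithLp.ofLp_sub, sub_dotProduct]
  module

theorem lyapunov_form_deriv {Am' : Matrix (Fin n) (Fin n) ℝ} (hPT : Pᵀ = P)
    (hP : Am'ᵀ * P + P * Am' = -Q) (e : Fin n → ℝ) (w : ℝ) :
    (Am' *ᵥ e + w • b) ⬝ᵥ (P *ᵥ e) + e ⬝ᵥ (P *ᵥ (Am' *ᵥ e + w • b)) =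
      -(e ⬝ᵥ (Q *ᵥ e)) + 2 * w * (e ⬝ᵥ (P *ᵥ b)) := by
  have h1 : b ⬝ᵥ (P *ᵥ e) = e ⬝ᵥ (P *ᵥ b) := by
    rw [Matrix.dotProduct_mulVec, ← Matrix.mulVec_transpose, hPT, dotProduct_comm]
  have h2 : (Am' *ᵥ e) ⬝ᵥ (P *ᵥ e) + e ⬝ᵥ (P *ᵥ (Am' *ᵥ e)) = -(e ⬝ᵥ (Q *ᵥ e)) := by
    rw [← dotProduct_neg, ← Matrix.neg_mulVec, ← hP, Matrix.add_mulVec, dotProduct_add,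
      ← Matrix.mulVec_mulVec, ← Matrix.mulVec_mulVec, Matrix.dotProduct_mulVec _ Am'ᵀ,
      Matrix.vecMul_transpose]
  rw [← h2, add_dotProduct, smul_dotProduct, Matrix.mulVec_add, dotProduct_add, Matrix.mulVec_smul,
    dotProduct_smul, h1]
  simp only [smul_eq_mul]
  ring

/-- The Lyapunov bound: `Γ_c eᵀ P e ≤ 4 M² + 2 M d_θ / μ` for the prediction error `e = x̂ - x`,
if `Q ≥ μ P` and `Θ` lies in the ball of radius `M`. -/
theorem IsAdaptiveLoop.lyapunov_bound
    (h : IsAdaptiveLoop A b c K C Θ P Γc r x₀ θhat₀ θ x u xhat θhat) (hΓc : 0 < Γc)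
    (hΘc : IsClosed Θ) (hΘ : Convex ℝ Θ) (h0 : θhat₀ ∈ Θ) (hPT : Pᵀ = P)
    (hP : (Am A b K)ᵀ * P + P * Am A b K = -Q) {μ M : ℝ} (hμ : 0 < μ)
    (hμPQ : ∀ e : Fin n → ℝ, μ * (e ⬝ᵥ (P *ᵥ e)) ≤ e ⬝ᵥ (Q *ᵥ e))
    (hM : ∀ p ∈ Θ, ‖p‖ ≤ M) (hθmem : ∀ t, 0 ≤ t → θ t ∈ Θ)
    (hθdiff : ContDiffOn ℝ 1 θ (Set.Ici 0))
    (hθderiv : ∀ t, 0 ≤ t → ‖derivWithin θ (Set.Ici 0) t‖ ≤ dθ) {T : ℝ} (hT : 0 ≤ T) :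
    Γc * ((xhat T - x T) ⬝ᵥ (P *ᵥ (xhat T - x T))) ≤ 4 * M ^ 2 + 2 * M * dθ / μ := by
  have hM0 : 0 ≤ M := (norm_nonneg _).trans (hM _ h0)
  have hdθ : 0 ≤ dθ := (norm_nonneg _).trans (hθderiv 0 le_rfl)
  have hmem : ∀ t, 0 ≤ t → θhat t ∈ Θ := fun t ht => h.θhat_mem hΓc.le hΘc hΘ h0 ht
  set e : ℝ → Fin n → ℝ := fun t => xhat t - x t with he
  set w : ℝ → ℝ := fun t => -((θhat t - θ t).ofLp ⬝ᵥ x t) with hw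
  set V : ℝ → ℝ := fun t => e t ⬝ᵥ (P *ᵥ e t) with hV
  set V' : ℝ → ℝ := fun t => -(e t ⬝ᵥ (Q *ᵥ e t)) + 2 * w t * (e t ⬝ᵥ (P *ᵥ b)) with hV'
  have hVd : ∀ t, 0 ≤ t → HasDerivWithinAt V (V' t) (Set.Ici 0) t := by
    intro t ht
    have hed := h.hasDerivWithinAt_sub ht
    refine (hasDerivWithinAt_dotProduct hed (hasDerivWithinAt_mulVec P hed)).congr_deriv ?_
    exact lyapunov_form_deriv hPT hP (e t) (w t)
  have hec : ContinuousOn e (Set.Ici 0) := h.continuousOn_xhat.sub h.plant.continuousOn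
  have hθc : ContinuousOn θ (Set.Ici 0) := hθdiff.continuousOn
  have hV'c : ContinuousOn V' (Set.Ici 0) := by
    have hofLp : ContinuousOn (fun t => (θhat t - θ t).ofLp) (Set.Ici 0) :=
      (PiLp.continuous_ofLp 2 _).comp_continuousOn (h.continuousOn_θhat.sub hθc)
    have hdot : ∀ {f g : ℝ → Fin n → ℝ}, ContinuousOn f (Set.Ici 0) → ContinuousOn g (Set.Ici 0) →
        ContinuousOn (fun t => f t ⬝ᵥ g t) (Set.Ici 0) := by
      intro f g hf hg
      have hc : Continuous fun p : (Fin n → ℝ) × (Fin n → ℝ) => p.1 ⬝ᵥ p.2 := by fun_prop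
      exact hc.comp_continuousOn (hf.prodMk hg)
    have hmv : Continuous fun v : Fin n → ℝ => Q *ᵥ v := by fun_prop
    exact (hdot hec (hmv.comp_continuousOn hec)).neg.add
      (((hdot hofLp h.plant.continuousOn).neg.const_mul 2).mul (hdot hec continuousOn_const))
  have hVAC : AbsolutelyContinuousOnInterval V 0 T :=
    absolutelyContinuousOnInterval_of_hasDerivWithinAt hT hVd hV'c
  have hθAC : AbsolutelyContinuousOnInterval θ 0 T := by
    refine (hθdiff.mono ?_).absolutelyContinuousOnInterval
    rw [Set.uIcc_of_le hT]
    exact Set.Icc_subset_Ici_self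
  have hnorm : ∀ {f : ℝ → EuclideanSpace ℝ (Fin n)}, AbsolutelyContinuousOnInterval f 0 T →
      AbsolutelyContinuousOnInterval (fun t => ‖f t‖) 0 T := fun hf =>
    absolutelyContinuousOnInterval_of_dist_le hf fun _ _ _ _ => dist_norm_norm_le _ _
  -- The term `-‖θ‖²` leaves `‖θ̂‖² - 2⟨θ̂, θ⟩`, so `θ'` enters the derivative of `U` only through
  -- `-2⟨θ̂, θ'⟩`. The drift then costs `2 M d_θ`, where `‖θ̂ - θ‖²` alone would cost `4 M d_θ`.
  set U : ℝ → ℝ := fun t => Γc * V t + ‖θhat t - θ t‖ ^ 2 - ‖θ t‖ ^ 2 with hU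
  have hUAC : AbsolutelyContinuousOnInterval U 0 T := by
    have h1 := hnorm ((h.absolutelyContinuous_θhat hT).sub hθAC)
    have h2 := hnorm hθAC
    have h3 := ((hVAC.const_mul Γc).add (h1.mul h1)).sub (h2.mul h2)
    refine absolutelyContinuousOnInterval_of_dist_le h3 fun s _ t _ => le_of_eq ?_
    simp [hU, pow_two]
  -- The bound `‖θ̂‖² - 2⟨θ̂, θ⟩ ≤ M² + 2 M²`.
  have hUle : ∀ t, 0 ≤ t → U t ≤ Γc * V t + 3 * M ^ 2 := by
    intro t ht
    have h1 := hM _ (hmem t ht)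
    have h2 := hM _ (hθmem t ht)
    have h3 := norm_sub_sq_real (θhat t) (θ t)
    have h4 := abs_le.mp (abs_real_inner_le_norm (θhat t) (θ t))
    have h5 : ‖θhat t‖ * ‖θ t‖ ≤ M * M := mul_le_mul h1 h2 (norm_nonneg _) hM0
    have h6 : ‖θhat t‖ ^ 2 ≤ M ^ 2 := pow_le_pow_left₀ (norm_nonneg _) h1 2
    simp only [hU]
    nlinarith
  have hU0 : U 0 ≤ 3 * M ^ 2 + 2 * M * dθ / μ := by
    have h1 : V 0 = 0 := by simp [hV, he, h.predictor_init, h.plant.init]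
    have h2 := hUle 0 le_rfl
    have h3 : 0 ≤ 2 * M * dθ / μ := by positivity
    rw [h1] at h2
    linarith
  have key := le_of_hasDerivAt_nonpos_above hT hUAC hU0 <| by
    filter_upwards [(h.adapt_integrable T hT).ae_hasDerivAt_integral] with t ht htT U' hU' hgt
    have ht0 : 0 ≤ t := htT.1.le
    set R := adaptRate Θ P b Γc (θhat t) (x t) (xhat t) with hR
    set y : EuclideanSpace ℝ (Fin n) :=
      WithLp.toLp 2 (((xhat t - x t) ⬝ᵥ (P *ᵥ b)) • x t) with hy
    have hθhatd : HasDerivAt θhat R t := by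
      have h1 := (ht (by rw [Set.uIcc_of_le hT]; exact Set.Ioo_subset_Icc_self htT) 0
        Set.left_mem_uIcc).const_add θhat₀
      refine h1.congr_of_eventuallyEq ?_
      filter_upwards [lt_mem_nhds htT.1] with s hs using h.adapt s (le_of_lt hs)
    have hIci : Set.Ici (0 : ℝ) ∈ nhds t := Ici_mem_nhds htT.1
    set θ' := derivWithin θ (Set.Ici 0) t with hθ'
    have hθd : HasDerivAt θ θ' t :=
      ((hθdiff.differentiableOn one_ne_zero t ht0).hasDerivWithinAt).hasDerivAt hIci
    have hd := (((hVd t ht0).hasDerivAt hIci).const_mul Γc).add (hθhatd.sub hθd).norm_sq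
      |>.sub hθd.norm_sq
    have hUeq : U' = Γc * V' t + 2 * inner ℝ (θhat t - θ t) (R - θ') - 2 * inner ℝ (θ t) θ' :=
      hU'.unique hd
    -- The true parameter `θ t` lies in `Θ`, so it serves as the test point for the projection; the
    -- term with `y` that remains cancels the cross term of `V'`.
    have hproj : inner ℝ (θhat t - θ t) R ≤ Γc * inner ℝ (θhat t - θ t) y := by
      have h1 := inner_sub_proj_nonpos hΘ (hθmem t ht0) (θhat t) y
      have h2 : R = Γc • proj Θ (θhat t) y := rfl
      rw [h2, real_inner_smul_right]
      refine mul_le_mul_of_nonneg_left ?_ hΓc.le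
      have h3 : inner ℝ (y - proj Θ (θhat t) y) (θ t - θhat t) =
          inner ℝ (θhat t - θ t) (proj Θ (θhat t) y) - inner ℝ (θhat t - θ t) y := by
        rw [real_inner_comm, ← inner_sub_right, ← neg_sub (θhat t) (θ t), inner_neg_left,
          ← inner_neg_right, neg_sub]
      linarith
    have hyin : inner ℝ (θhat t - θ t) y = -(w t) * (e t ⬝ᵥ (P *ᵥ b)) := by
      rw [inner_eq_dotProduct, hy, dotProduct_smul, smul_eq_mul]
      simp only [hw, he]
      ring
    have hθ'b : -inner ℝ (θhat t) θ' ≤ M * dθ := by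
      have h1 := abs_le.mp (abs_real_inner_le_norm (θhat t) θ')
      have h2 : ‖θhat t‖ * ‖θ'‖ ≤ M * dθ :=
        mul_le_mul (hM _ (hmem t ht0)) (hθderiv t ht0) (norm_nonneg _) hM0
      linarith [h1.1]
    have hle : U' ≤ -(Γc * (e t ⬝ᵥ (Q *ᵥ e t))) + 2 * (M * dθ) := by
      rw [hUeq, inner_sub_right, inner_sub_left (θhat t) (θ t) θ']
      rw [hyin] at hproj
      simp only [hV']
      nlinarith
    -- Above the barrier `3 M² + 2 M d_θ / μ` the parameter part accounts for at most `3 M²`, so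
    -- `Γ_c V` is large enough for the decay `μ Γ_c V` to absorb the drift `2 M d_θ`.
    have hVlow : 2 * M * dθ / μ ≤ Γc * V t := by
      have := hUle t ht0
      linarith
    have h1 : 2 * M * dθ ≤ Γc * V t * μ := (div_le_iff₀ hμ).mp hVlow
    have h2 : Γc * (μ * V t) ≤ Γc * (e t ⬝ᵥ (Q *ᵥ e t)) :=
      mul_le_mul_of_nonneg_left (hμPQ (e t)) hΓc.le
    linarith
  -- Removing `-‖θ‖²` costs one more `M²`, which makes `4 M²` in all.
  have h1 : ‖θ T‖ ^ 2 ≤ M ^ 2 := pow_le_pow_left₀ (norm_nonneg _) (hM _ (hθmem T hT)) 2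
  have h2 : 0 ≤ ‖θhat T - θ T‖ ^ 2 := sq_nonneg _
  have h3 : U T = Γc * (e T ⬝ᵥ (P *ᵥ e T)) + ‖θhat T - θ T‖ ^ 2 - ‖θ T‖ ^ 2 := rfl
  linarith

/-- Since `∑ 4 pᵢ² = 4 ‖p‖²`, both maxima are attained at the same point, and a single radius `M`
describes `θ_m`. -/
theorem thetaM_eq (hΘ : IsCompact Θ) (hne : Θ.Nonempty) (P Q : Matrix (Fin n) (Fin n) ℝ)
    (dθ : ℝ) : ∃ M, (∀ p ∈ Θ, ‖p‖ ≤ M) ∧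
      thetaM Θ P Q dθ = 4 * M ^ 2 + 2 * (dθ * lamMax P / lamMin Q) * M := by
  obtain ⟨p, hp, hmax⟩ := hΘ.exists_isMaxOn hne continuous_norm.continuousOn
  have hle : ∀ q ∈ Θ, ‖q‖ ≤ ‖p‖ := fun q hq => hmax hq
  refine ⟨‖p‖, hle, ?_⟩
  have hsum : ∀ q : EuclideanSpace ℝ (Fin n), ∑ i, 4 * q i ^ 2 = 4 * ‖q‖ ^ 2 := by
    intro q
    rw [EuclideanSpace.real_norm_sq_eq, Finset.mul_sum]
  have h1 : IsGreatest ((fun p : EuclideanSpace ℝ (Fin n) => ∑ i, 4 * p i ^ 2) '' Θ)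
      (4 * ‖p‖ ^ 2) := by
    refine ⟨⟨p, hp, hsum p⟩, ?_⟩
    rintro _ ⟨q, hq, rfl⟩
    simp only [hsum]
    exact mul_le_mul_of_nonneg_left (pow_le_pow_left₀ (norm_nonneg _) (hle q hq) 2) (by norm_num)
  have h2 : IsGreatest ((fun p : EuclideanSpace ℝ (Fin n) => ‖p‖) '' Θ) ‖p‖ := by
    refine ⟨⟨p, hp, rfl⟩, ?_⟩
    rintro _ ⟨q, hq, rfl⟩
    exact hle q hq
  rw [thetaM, h1.csSup_eq, h2.csSup_eq]

/-- The Lyapunov bound with `μ = λ_min(Q) / λ_max(P)`, for which `μ P ≤ λ_min(Q) I ≤ Q`; then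
`λ_min(P)` and the comparison of the maximum norm with the Euclidean norm give the result. -/
theorem IsAdaptiveLoop.norm_sub_le (hn : 0 < n)
    (h : IsAdaptiveLoop A b c K C Θ P Γc r x₀ θhat₀ θ x u xhat θhat) (hΓc : 0 < Γc)
    (hK : IsHurwitz (Am A b K)) (hQ : Q.PosDef)
    (hP : (Am A b K)ᵀ * P + P * Am A b K = -Q)
    (hΘc : IsCompact Θ) (hΘ : Convex ℝ Θ) (h0 : θhat₀ ∈ Θ) (hθmem : ∀ t, 0 ≤ t → θ t ∈ Θ)
    (hθdiff : ContDiffOn ℝ 1 θ (Set.Ici 0))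
    (hθderiv : ∀ t, 0 ≤ t → ‖derivWithin θ (Set.Ici 0) t‖ ≤ dθ) {t : ℝ} (ht : 0 ≤ t) :
    ‖xhat t - x t‖ ≤ Real.sqrt (thetaM Θ P Q dθ / (lamMin P * Γc)) := by
  have hPpos := lyapunov_posDef hK hQ hP
  have hPT : Pᵀ = P := by simpa using hPpos.isHermitian.eq
  have hlQ := lamMin_pos hn hQ
  have hLP := lamMax_pos hn hPpos
  have hlP := lamMin_pos hn hPpos
  obtain ⟨M, hM, hθm⟩ := thetaM_eq hΘc ⟨_, h0⟩ P Q dθ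
  have hμPQ : ∀ e : Fin n → ℝ,
      lamMin Q / lamMax P * (e ⬝ᵥ (P *ᵥ e)) ≤ e ⬝ᵥ (Q *ᵥ e) := by
    intro e
    refine le_trans ?_ (lamMin_mul_le hQ.isHermitian e)
    rw [div_mul_eq_mul_div, div_le_iff₀ hLP]
    have := mul_le_mul_of_nonneg_left (le_lamMax_mul hPpos.isHermitian e) hlQ.le
    linarith
  have key := h.lyapunov_bound hΓc hΘc.isClosed hΘ h0 hPT hP (div_pos hlQ hLP) hμPQ hM hθmem
    hθdiff hθderiv ht
  have hθm' : 4 * M ^ 2 + 2 * M * dθ / (lamMin Q / lamMax P) = thetaM Θ P Q dθ := by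
    rw [hθm]
    field_simp
  rw [hθm'] at key
  refine (pi_norm_le_iff_of_nonneg (Real.sqrt_nonneg _)).mpr fun i => ?_
  refine Real.abs_le_sqrt ?_
  rw [le_div_iff₀ (mul_pos hlP hΓc)]
  have h1 : (xhat t - x t) i ^ 2 ≤ (xhat t - x t) ⬝ᵥ (xhat t - x t) := by
    rw [pow_two]
    exact Finset.single_le_sum (f := fun i => (xhat t - x t) i * (xhat t - x t) i)
      (fun i _ => mul_self_nonneg _) (Finset.mem_univ i)
  have h2 := lamMin_mul_le hPpos.isHermitian (xhat t - x t)
  calc _ ≤ ((xhat t - x t) ⬝ᵥ (xhat t - x t)) * (lamMin P * Γc) :=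
        mul_le_mul_of_nonneg_right h1 (mul_pos hlP hΓc).le
    _ = Γc * (lamMin P * ((xhat t - x t) ⬝ᵥ (xhat t - x t))) := by ring
    _ ≤ _ := mul_le_mul_of_nonneg_left h2 hΓc.le
    _ ≤ _ := key

end Adaptive

/-! ### Responses as operators, and gains -/

theorem StrictlyProper.proper {G : RatFunc ℝ} (h : StrictlyProper G) : Proper G := by
  by_cases h0 : G = 0
  · rw [h0]; exact proper_zero
  · exact (h.intDegree_neg h0).le

theorem continuousOn_response (G : RatFunc ℝ) {v : ℝ → ℝ} {T : ℝ} (hT : 0 ≤ T)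
    (hv : ContinuousOn v (Set.Icc 0 T)) : ContinuousOn (response G v) (Set.Icc 0 T) := by
  rw [continuousOn_iff_continuous_domRestrict]
  have h : (Set.Icc 0 T).domRestrict (response G v) = ioOp hT G (Sig.mk v hv) := by
    funext t
    exact (ioOp_apply hT G (Sig.mk v hv) (fun _ => rfl) t).symm
  rw [h]
  exact Sig.continuous _

theorem ioOp_mk_apply (G : RatFunc ℝ) {v : ℝ → ℝ} {T : ℝ} (hT : 0 ≤ T)
    (hv : ContinuousOn v (Set.Icc 0 T)) (t : Set.Icc (0 : ℝ) T) :
    ioOp hT G (Sig.mk v hv) t = response G v t :=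
  ioOp_apply hT G (Sig.mk v hv) (fun _ => rfl) t

theorem mk_response (G : RatFunc ℝ) {v : ℝ → ℝ} {T : ℝ} (hT : 0 ≤ T)
    (hv : ContinuousOn v (Set.Icc 0 T)) (h : ContinuousOn (response G v) (Set.Icc 0 T)) :
    Sig.mk (response G v) h = ioOp hT G (Sig.mk v hv) := by
  ext t
  exact (ioOp_apply hT G (Sig.mk v hv) (fun _ => rfl) t).symm

/-- Needed because the gain requirement is stated with `C - 1` and the bound with `1 - C`. -/
theorem l1Gain_neg {G : RatFunc ℝ} (hG : Proper G) : l1Gain (-G) = l1Gain G := by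
  have hexp : expansion (-G) = PowerSeries.C (-1) * expansion G := by
    rw [← expansion_C, ← expansion_mul (proper_C _) hG]
    simp
  have hcoeff : ∀ k, PowerSeries.coeff k (expansion (-G)) =
      (-1) * PowerSeries.coeff k (expansion G) := by
    intro k
    rw [hexp, PowerSeries.coeff_C_mul]
  have himp : ∀ t, impulse (-G) t = -impulse G t := by
    intro t
    rw [impulse_eq_expSum, impulse_eq_expSum]
    simp only [hcoeff]
    rw [expSum_const_mul, neg_one_mul]
  unfold l1Gain feedthrough
  simp only [himp, hcoeff, abs_neg, neg_one_mul]

theorem sum_l1Gain_le_l1GainMat {p m : ℕ} (H : Matrix (Fin p) (Fin m) (RatFunc ℝ)) (i : Fin p) :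
    ∑ j, l1Gain (H i j) ≤ l1GainMat H :=
  le_ciSup (f := fun i => ∑ j, l1Gain (H i j)) (Set.finite_range _).bddAbove i

theorem l1GainMat_nonneg {p m : ℕ} (H : Matrix (Fin p) (Fin m) (RatFunc ℝ)) :
    0 ≤ l1GainMat H :=
  Real.iSup_nonneg fun _ => Finset.sum_nonneg fun _ _ => l1Gain_nonneg _

theorem linftyNorm_le {E : Type*} [NormedAddCommGroup E] {ξ : ℝ → E} {γ : ℝ}
    (h : ∀ t, 0 ≤ t → ‖ξ t‖ ≤ γ) : linftyNorm ξ ≤ ENNReal.ofReal γ := by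
  refine iSup₂_le fun t ht => ?_
  rw [← ofReal_norm]
  exact ENNReal.ofReal_le_ofReal (h t ht)

theorem abs_dotProduct_le_sum {n : ℕ} (v w : Fin n → ℝ) : |v ⬝ᵥ w| ≤ (∑ i, |v i|) * ‖w‖ := by
  calc |v ⬝ᵥ w| ≤ ∑ i, |v i * w i| := Finset.abs_sum_le_sum_abs _ _
    _ ≤ ∑ i, |v i| * ‖w‖ := Finset.sum_le_sum fun i _ => by
        rw [abs_mul]
        exact mul_le_mul_of_nonneg_left (norm_le_pi_norm w i) (abs_nonneg _)
    _ = _ := by rw [Finset.sum_mul]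

section Loops

variable {n : ℕ} {A : Matrix (Fin n) (Fin n) ℝ} {b c K : Fin n → ℝ} {C : RatFunc ℝ}
  {P Q : Matrix (Fin n) (Fin n) ℝ} {Γc : ℝ} {Θ : Set (EuclideanSpace ℝ (Fin n))}
  {r : ℝ → ℝ} {x₀ : Fin n → ℝ} {θhat₀ : EuclideanSpace ℝ (Fin n)}
  {θ : ℝ → EuclideanSpace ℝ (Fin n)} {dθ : ℝ} {x : ℝ → Fin n → ℝ} {u : ℝ → ℝ}
  {xhat : ℝ → Fin n → ℝ} {θhat : ℝ → EuclideanSpace ℝ (Fin n)}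
  {xref : ℝ → Fin n → ℝ} {uref : ℝ → ℝ}

theorem sum_abs_le_thetaMax (hΘ : IsCompact Θ) {p : EuclideanSpace ℝ (Fin n)} (hp : p ∈ Θ) :
    ∑ i, |p i| ≤ thetaMax Θ := by
  have hc : Continuous fun p : EuclideanSpace ℝ (Fin n) => ∑ i, |p i| := by fun_prop
  exact le_csSup (hΘ.image hc).bddAbove ⟨p, hp, rfl⟩

theorem proper_Gbar (hC : StrictlyProper C) (i : Fin n) : Proper (Gbar A b K C i 0) :=
  (proper_stateTransfer (Am A b K) b i).mul (hC.proper.sub proper_one)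

theorem stable_Gbar (hK : IsHurwitz (Am A b K)) (hC : Stable C) (i : Fin n) :
    Stable (Gbar A b K C i 0) := by
  have h1 : Stable (1 : RatFunc ℝ) := by simpa using stable_C 1
  exact (stable_stateTransfer b hK i).mul (hC.sub h1)

theorem l1GainMat_HoOneSub (hC : StrictlyProper C) :
    l1GainMat (HoOneSub A b K C) = l1GainMat (Gbar A b K C) := by
  unfold l1GainMat
  refine congrArg _ (funext fun i => Finset.sum_congr rfl fun j _ => ?_)
  have hj : j = 0 := Subsingleton.elim _ _
  rw [hj, ← l1Gain_neg (proper_Gbar hC i)]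
  congr 1
  simp only [HoOneSub, Gbar]
  ring

theorem continuousOn_dotProduct {f g : ℝ → Fin n → ℝ} {s : Set ℝ} (hf : ContinuousOn f s)
    (hg : ContinuousOn g s) : ContinuousOn (fun t => f t ⬝ᵥ g t) s := by
  have hc : Continuous fun p : (Fin n → ℝ) × (Fin n → ℝ) => p.1 ⬝ᵥ p.2 := by fun_prop
  exact hc.comp_continuousOn (hf.prodMk hg)

theorem continuousOn_ofLp {f : ℝ → EuclideanSpace ℝ (Fin n)} {s : Set ℝ}
    (hf : ContinuousOn f s) : ContinuousOn (fun t => (f t).ofLp) s :=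
  (PiLp.continuous_ofLp 2 _).comp_continuousOn hf

/-- The difference of the filtered signals of the adaptive loop and of the reference loop. -/
def filterDiff (A : Matrix (Fin n) (Fin n) ℝ) (b c K : Fin n → ℝ) (C : RatFunc ℝ) (r : ℝ → ℝ)
    (θ θhat : ℝ → EuclideanSpace ℝ (Fin n)) (x xref : ℝ → Fin n → ℝ) (t : ℝ) : ℝ :=
  response C (fun τ => (θhat τ).ofLp ⬝ᵥ x τ + kg A b c K * r τ) t -
    response C (fun τ => kg A b c K * r τ + (θ τ).ofLp ⬝ᵥ xref τ) t

theorem control_sub (h : IsAdaptiveLoop A b c K C Θ P Γc r x₀ θhat₀ θ x u xhat θhat)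
    (href : IsReferenceLoop A b c K C r x₀ θ xref uref) {t : ℝ} (ht : 0 ≤ t) :
    u t - uref t = filterDiff A b c K C r θ θhat x xref t - K ⬝ᵥ (x t - xref t) := by
  rw [h.control t ht, href.control t ht, dotProduct_sub, filterDiff]
  ring

theorem hasDerivWithinAt_state_sub
    (h : IsAdaptiveLoop A b c K C Θ P Γc r x₀ θhat₀ θ x u xhat θhat)
    (href : IsReferenceLoop A b c K C r x₀ θ xref uref) {t : ℝ} (ht : 0 ≤ t) :
    HasDerivWithinAt (fun t => x t - xref t) (Am A b K *ᵥ (x t - xref t) +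
      (filterDiff A b c K C r θ θhat x xref t - (θ t).ofLp ⬝ᵥ (x t - xref t)) • b)
      (Set.Ici 0) t := by
  refine ((h.plant.ode t ht).sub (href.plant.ode t ht)).congr_deriv ?_
  have hu : u t = uref t + (filterDiff A b c K C r θ θhat x xref t - K ⬝ᵥ (x t - xref t)) := by
    rw [← control_sub h href ht]; ring
  rw [hu, Am_mulVec, Matrix.mulVec_sub, dotProduct_sub (θ t).ofLp]
  module

/-- The two error identities: `e = H_o (C - 1) θᵀe - C x̃` and, for an output `v` of minimum phase,
`C ((θ̂ - θ)ᵀ x + θᵀ e) = C θᵀ e - C (vᵀ H_o)⁻¹ vᵀ x̃`, where `e = x - x_ref`, `x̃ = x̂ - x`. -/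
theorem error_identities (hC : StrictlyProper C)
    (h : IsAdaptiveLoop A b c K C Θ P Γc r x₀ θhat₀ θ x u xhat θhat)
    (href : IsReferenceLoop A b c K C r x₀ θ xref uref) (hr : ContinuousOn r (Set.Ici 0))
    (hθ : ContinuousOn θ (Set.Ici 0)) {t : ℝ} (ht : 0 ≤ t) :
    (∀ i, x t i - xref t i =
      response (Gbar A b K C i 0) (fun τ => (θ τ).ofLp ⬝ᵥ (x τ - xref τ)) t -
        response C (fun τ => (xhat τ - x τ) i) t) ∧
    ∀ v, IsMinPhaseOutput A b K v → filterDiff A b c K C r θ θhat x xref t =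
      response C (fun τ => (θ τ).ofLp ⬝ᵥ (x τ - xref τ)) t -
        ∑ j, response (filteredInverse A b K C v 0 j) (fun τ => (xhat τ - x τ) j) t := by
  have hsub : Set.Icc 0 t ⊆ Set.Ici (0 : ℝ) := Set.Icc_subset_Ici_self
  have hx := h.plant.continuousOn.mono hsub
  have hxr := href.plant.continuousOn.mono hsub
  have hxh := h.continuousOn_xhat.mono hsub
  have hθ' := continuousOn_ofLp (hθ.mono hsub)
  have hθh' := continuousOn_ofLp (h.continuousOn_θhat.mono hsub)
  have hr' := (hr.mono hsub).const_mul (kg A b c K)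
  have hw : ContinuousOn (fun τ => -((θhat τ - θ τ).ofLp ⬝ᵥ x τ)) (Set.Icc 0 t) :=
    (continuousOn_dotProduct
      (continuousOn_ofLp ((h.continuousOn_θhat.mono hsub).sub (hθ.mono hsub))) hx).neg
  have hxt : ∀ i, ContinuousOn (fun τ => (xhat τ - x τ) i) (Set.Icc 0 t) := fun i =>
    (continuous_apply i).comp_continuousOn (hxh.sub hx)
  have he : ∀ i, ContinuousOn (fun τ => (x τ - xref τ) i) (Set.Icc 0 t) := fun i =>
    (continuous_apply i).comp_continuousOn (hx.sub hxr)
  have hs : ContinuousOn (fun τ => (θ τ).ofLp ⬝ᵥ (x τ - xref τ)) (Set.Icc 0 t) :=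
    continuousOn_dotProduct hθ' (hx.sub hxr)
  have ha : ContinuousOn (fun τ => (θhat τ).ofLp ⬝ᵥ x τ + kg A b c K * r τ) (Set.Icc 0 t) :=
    (continuousOn_dotProduct hθh' hx).add hr'
  have ha' : ContinuousOn (fun τ => kg A b c K * r τ + (θ τ).ofLp ⬝ᵥ xref τ) (Set.Icc 0 t) :=
    hr'.add (continuousOn_dotProduct hθ' hxr)
  have hd : ContinuousOn (filterDiff A b c K C r θ θhat x xref) (Set.Icc 0 t) :=
    (continuousOn_response C ht ha).sub (continuousOn_response C ht ha')
  set W : Sig t := Sig.mk _ hw with hW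
  set S : Sig t := Sig.mk _ hs with hS
  set H := stateTransfer (Am A b K) b with hH
  have hHp : ∀ i, Proper (H i) := proper_stateTransfer (Am A b K) b
  have hX : ∀ i, Sig.mk _ (hxt i) = ioOp ht (H i) W :=
    eq_ioOp_of_hasDerivWithinAt (Am A b K) b ht (y := fun τ => xhat τ - x τ)
      (by simp [h.predictor_init, h.plant.init]) (fun s hs => h.hasDerivWithinAt_sub hs) hxt hw
  -- The reference input cancels in the difference of the filter inputs: `θ̂ᵀx - θᵀx_ref = θᵀe - w`.
  have hD : Sig.mk _ hd = ioOp ht C S - ioOp ht C W := by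
    have h1 : Sig.mk _ ha - Sig.mk _ ha' = S - W := by
      ext τ
      simp only [hS, hW, Sig.sub_apply, Sig.mk_apply, dotProduct_sub, WithLp.ofLp_sub,
        sub_dotProduct]
      ring
    rw [← map_sub, ← h1, map_sub, ← mk_response C ht ha (continuousOn_response C ht ha),
      ← mk_response C ht ha' (continuousOn_response C ht ha')]
    rfl
  have hE : ∀ i, Sig.mk _ (he i) = ioOp ht (Gbar A b K C i 0) S - ioOp ht C (Sig.mk _ (hxt i)) := by
    intro i
    have h1 := eq_ioOp_of_hasDerivWithinAt (Am A b K) b ht (y := fun τ => x τ - xref τ)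
      (by simp [h.plant.init, href.plant.init])
      (fun s hs => hasDerivWithinAt_state_sub h href hs) he (hd.sub hs) i
    -- Commuting the filter past `H_o` turns `H_o C w` into `C x̃`, the only trace of the parameter
    -- error in `e`.
    have h3 : ioOp ht C * ioOp ht (H i) = ioOp ht (H i) * ioOp ht C := by
      rw [← ioOp_mul ht hC.proper (hHp i), mul_comm, ioOp_mul ht (hHp i) hC.proper]
    have h4 : ioOp ht (Gbar A b K C i 0) = ioOp ht (H i) * (ioOp ht C - 1) := by
      rw [← ioOp_one ht, ← ioOp_sub ht hC.proper proper_one,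
        ← ioOp_mul ht (hHp i) (hC.proper.sub proper_one)]
      rfl
    rw [h1]
    change ioOp ht (H i) (Sig.mk _ hd - S) = _
    rw [hD, hX, h4, ← mul_apply_eq_comp (ioOp ht C), h3]
    simp only [mul_apply_eq_comp, sub_apply, map_sub, one_apply_eq_self]
    abel
  have htt : t ∈ Set.Icc 0 t := ⟨ht, le_rfl⟩
  refine ⟨fun i => ?_, fun v hv => ?_⟩
  · have h1 := congrArg (fun z : Sig t => z ⟨t, htt⟩) (hE i)
    simp only [Sig.sub_apply] at h1
    rw [hS, ioOp_mk_apply, ioOp_mk_apply] at h1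
    exact h1
  · have hFp := proper_filteredInverse hC hv 0
    -- The input `w` is observed only through `x̃ = H_o w`; the proper left inverse of `H_o`,
    -- filtered by `C`, recovers `C w`.
    have hCW : ioOp ht C W =
        ∑ j, ioOp ht (filteredInverse A b K C v 0 j) (Sig.mk _ (hxt j)) := by
      rw [show ioOp ht C = ioOp ht (∑ j, filteredInverse A b K C v 0 j * H j) from
        congrArg _ (sum_filteredInverse_mul_Ho hv 0).symm, ioOp_sum ht _ fun j _ => (hFp j).mul (hHp j), sum_apply]
      refine Finset.sum_congr rfl fun j _ => ?_
      rw [hX, ioOp_mul ht (hFp j) (hHp j)]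
      rfl
    have h1 := congrArg (fun z : Sig t => z ⟨t, htt⟩) hD
    simp only [Sig.sub_apply, hCW, Sig.sum_apply] at h1
    rw [hS, ioOp_mk_apply, Finset.sum_congr rfl fun j _ =>
      ioOp_mk_apply _ ht (hxt j) ⟨t, htt⟩] at h1
    exact h1

/-- Small gain on a finite horizon: the maximum `m` of `‖e‖` over `[0, T]` is finite by continuity
and satisfies `m ≤ g θ_max m + ‖C‖ ρ`, with `g` the gain of `H_o (C - 1)`. As `g θ_max < 1`, this
can be solved for `m`, with a bound independent of `T`. -/
theorem norm_state_sub_le (hK : IsHurwitz (Am A b K)) (hC : StrictlyProper C)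
    (hCs : Stable C) (hΘ : IsCompact Θ)
    (hgain : l1GainMat (Gbar A b K C) * thetaMax Θ < 1)
    (h : IsAdaptiveLoop A b c K C Θ P Γc r x₀ θhat₀ θ x u xhat θhat)
    (href : IsReferenceLoop A b c K C r x₀ θ xref uref) (hr : ContinuousOn r (Set.Ici 0))
    (hθ : ContinuousOn θ (Set.Ici 0)) (hθmem : ∀ t, 0 ≤ t → θ t ∈ Θ) {ρ : ℝ}
    (hρ : ∀ t, 0 ≤ t → ‖xhat t - x t‖ ≤ ρ) {T : ℝ} (hT : 0 ≤ T) :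
    ‖x T - xref T‖ ≤ l1Gain C / (1 - l1GainMat (HoOneSub A b K C) * thetaMax Θ) * ρ := by
  have hsub : Set.Icc 0 T ⊆ Set.Ici (0 : ℝ) := Set.Icc_subset_Ici_self
  have hec : ContinuousOn (fun t => x t - xref t) (Set.Icc 0 T) :=
    (h.plant.continuousOn.mono hsub).sub (href.plant.continuousOn.mono hsub)
  obtain ⟨t₀, ht₀, hmax⟩ := isCompact_Icc.exists_isMaxOn ⟨T, hT, le_rfl⟩ hec.norm
  have hle : ∀ t ∈ Set.Icc 0 T, ‖x t - xref t‖ ≤ ‖x t₀ - xref t₀‖ := fun t ht => hmax ht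
  set m := ‖x t₀ - xref t₀‖ with hm
  have hm0 : 0 ≤ m := norm_nonneg _
  have hρ0 : 0 ≤ ρ := (norm_nonneg _).trans (hρ 0 le_rfl)
  have hθm0 : 0 ≤ thetaMax Θ :=
    (Finset.sum_nonneg fun _ _ => abs_nonneg _).trans
      (sum_abs_le_thetaMax hΘ (hθmem 0 le_rfl))
  have hbound : m ≤ l1GainMat (Gbar A b K C) * (thetaMax Θ * m) + l1Gain C * ρ := by
    refine (pi_norm_le_iff_of_nonneg ?_).mpr fun i => ?_
    · exact add_nonneg (mul_nonneg (l1GainMat_nonneg _) (mul_nonneg hθm0 hm0))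
        (mul_nonneg (l1Gain_nonneg C) hρ0)
    rw [Pi.sub_apply, (error_identities hC h href hr hθ ht₀.1).1 i, Real.norm_eq_abs]
    refine (abs_sub _ _).trans (add_le_add ?_ ?_)
    · have hg : l1Gain (Gbar A b K C i 0) ≤ l1GainMat (Gbar A b K C) := by
        simpa using sum_l1Gain_le_l1GainMat (Gbar A b K C) i
      refine (abs_response_le (proper_Gbar hC i) (stable_Gbar hK hCs i) ht₀.1
        (M := thetaMax Θ * m) fun s hs => ?_).trans
        (mul_le_mul_of_nonneg_right hg (mul_nonneg hθm0 hm0))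
      refine (abs_dotProduct_le_sum _ _).trans ?_
      exact mul_le_mul (sum_abs_le_thetaMax hΘ (hθmem s hs.1))
        (hle s ⟨hs.1, hs.2.trans ht₀.2⟩) (norm_nonneg _) hθm0
    · exact abs_response_le hC.proper hCs ht₀.1 fun s hs =>
        (norm_le_pi_norm _ i).trans (hρ s hs.1)
  refine (hle T ⟨hT, le_rfl⟩).trans ?_
  rw [l1GainMat_HoOneSub hC, div_mul_eq_mul_div, le_div_iff₀ (by linarith)]
  linarith

end Loops

end L1Adaptive

end

/-! ### The bounds for state and control -/

theorem theorem4 {n : ℕ} (hn : 0 < n)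
    -- plant data and state feedback
    (A : Matrix (Fin n) (Fin n) ℝ) (b c K : Fin n → ℝ)
    (hctrl : L1Adaptive.IsControllable A b)
    (hK : L1Adaptive.IsHurwitz (L1Adaptive.Am A b K))
    -- the low-pass filter
    (C : RatFunc ℝ) (hCproper : L1Adaptive.StrictlyProper C) (hCstable : L1Adaptive.Stable C)
    (hC0 : RatFunc.eval (RingHom.id ℝ) 0 C = 1)
    -- the adaptive law
    (P Q : Matrix (Fin n) (Fin n) ℝ) (hQ : Q.PosDef)
    (hP : (L1Adaptive.Am A b K)ᵀ * P + P * L1Adaptive.Am A b K = -Q)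
    (Γc : ℝ) (hΓc : 0 < Γc)
    (Θ : Set (EuclideanSpace ℝ (Fin n))) (hΘcompact : IsCompact Θ) (hΘconvex : Convex ℝ Θ)
    -- the gain requirement
    (hgain : L1Adaptive.l1GainMat (L1Adaptive.Gbar A b K C) * L1Adaptive.thetaMax Θ < 1)
    -- the reference signal and the initial values
    (r : ℝ → ℝ) (hrcont : ContinuousOn r (Set.Ici 0))
    (hrbdd : ∃ R : ℝ, ∀ t, 0 ≤ t → |r t| ≤ R)
    (x₀ : Fin n → ℝ) (θhat₀ : EuclideanSpace ℝ (Fin n)) (hθhat₀ : θhat₀ ∈ Θ)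
    -- the time-varying unknown parameter
    (θ : ℝ → EuclideanSpace ℝ (Fin n)) (dθ : ℝ)
    (hθmem : ∀ t, 0 ≤ t → θ t ∈ Θ)
    (hθdiff : ContDiffOn ℝ 1 θ (Set.Ici 0))
    (hθderiv : ∀ t, 0 ≤ t → ‖derivWithin θ (Set.Ici 0) t‖ ≤ dθ)
    -- the signals of the adaptive closed loop and of the reference closed loop
    (x : ℝ → Fin n → ℝ) (u : ℝ → ℝ) (xhat : ℝ → Fin n → ℝ)
    (θhat : ℝ → EuclideanSpace ℝ (Fin n))
    (hloop : L1Adaptive.IsAdaptiveLoop A b c K C Θ P Γc r x₀ θhat₀ θ x u xhat θhat)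
    (xref : ℝ → Fin n → ℝ) (uref : ℝ → ℝ)
    (href : L1Adaptive.IsReferenceLoop A b c K C r x₀ θ xref uref) :
    L1Adaptive.linftyNorm (fun t => x t - xref t) ≤
        ENNReal.ofReal (L1Adaptive.gamma3 A b K C Θ P Q Γc dθ) ∧
      (∃ co : Fin n → ℝ, L1Adaptive.IsMinPhaseOutput A b K co) ∧
      ∀ co : Fin n → ℝ, L1Adaptive.IsMinPhaseOutput A b K co →
        L1Adaptive.linftyNorm (fun t => u t - uref t) ≤
          ENNReal.ofReal (L1Adaptive.gamma4 A b K C Θ P Q Γc dθ co) := by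
  have hρ : ∀ t, 0 ≤ t → ‖xhat t - x t‖ ≤
      Real.sqrt (L1Adaptive.thetaM Θ P Q dθ / (L1Adaptive.lamMin P * Γc)) := fun t ht =>
    hloop.norm_sub_le hn hΓc hK hQ hP hΘcompact hΘconvex hθhat₀ hθmem hθdiff hθderiv ht
  have he : ∀ t, 0 ≤ t → ‖x t - xref t‖ ≤ L1Adaptive.gamma3 A b K C Θ P Q Γc dθ := fun t ht =>
    L1Adaptive.norm_state_sub_le hK hCproper hCstable hΘcompact hgain hloop href hrcont
      hθdiff.continuousOn hθmem hρ ht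
  refine ⟨L1Adaptive.linftyNorm_le he, L1Adaptive.exists_isMinPhaseOutput hn hctrl hK,
    fun co hco => L1Adaptive.linftyNorm_le fun t ht => ?_⟩
  have hγ0 : 0 ≤ L1Adaptive.gamma3 A b K C Θ P Q Γc dθ := (norm_nonneg _).trans (he 0 le_rfl)
  rw [L1Adaptive.control_sub hloop href ht,
    (L1Adaptive.error_identities hCproper hloop href hrcont hθdiff.continuousOn ht).2 co hco,
    Real.norm_eq_abs]
  have h1 : |L1Adaptive.response C (fun τ => (θ τ).ofLp ⬝ᵥ (x τ - xref τ)) t| ≤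
      L1Adaptive.l1Gain C *
        (L1Adaptive.thetaMax Θ * L1Adaptive.gamma3 A b K C Θ P Q Γc dθ) := by
    refine L1Adaptive.abs_response_le hCproper.proper hCstable ht fun s hs => ?_
    refine (L1Adaptive.abs_dotProduct_le_sum _ _).trans ?_
    have hle := L1Adaptive.sum_abs_le_thetaMax hΘcompact (hθmem s hs.1)
    exact mul_le_mul hle (he s hs.1) (norm_nonneg _)
      ((Finset.sum_nonneg fun _ _ => abs_nonneg _).trans hle)
  have h2 : |∑ j, L1Adaptive.response (L1Adaptive.filteredInverse A b K C co 0 j)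
      (fun τ => (xhat τ - x τ) j) t| ≤ L1Adaptive.l1GainMat (L1Adaptive.filteredInverse A b K C co) *
        Real.sqrt (L1Adaptive.thetaM Θ P Q dθ / (L1Adaptive.lamMin P * Γc)) := by
    refine (Finset.abs_sum_le_sum_abs _ _).trans ?_
    refine le_trans ?_ (mul_le_mul_of_nonneg_right
      (L1Adaptive.sum_l1Gain_le_l1GainMat _ (0 : Fin 1)) (Real.sqrt_nonneg _))
    rw [Finset.sum_mul]
    exact Finset.sum_le_sum fun j _ =>
      L1Adaptive.abs_response_le (L1Adaptive.proper_filteredInverse hCproper hco 0 j)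
        (L1Adaptive.stable_filteredInverse hCstable hco 0 j) ht fun s hs =>
          (norm_le_pi_norm _ j).trans (hρ s hs.1)
  have h3 : |K ⬝ᵥ (x t - xref t)| ≤
      (∑ i, |K i|) * L1Adaptive.gamma3 A b K C Θ P Q Γc dθ :=
    (L1Adaptive.abs_dotProduct_le_sum _ _).trans (mul_le_mul_of_nonneg_left (he t ht)
      (Finset.sum_nonneg fun _ _ => abs_nonneg _))
  refine (abs_sub _ _).trans ?_
  refine (add_le_add ((abs_sub _ _).trans (add_le_add h1 h2)) h3).trans (le_of_eq ?_)
  rw [L1Adaptive.gamma4]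
  ring
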